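/- Setting. Let $M\ge 1$ agents be given, hyperparameters $l_1,\dots,l_D,\sigma_f,\sigma_\epsilon>0$, and the kernel $k(x,x')=\sigma_f^2\exp\{-\sum_{d}(x_d-x_d')^2/l_d^2\}$ on $\mathbb R^D$. For each $n$, agent $i$ has $n$ inputs $X_i\in(\mathbb R^{D})^n$ and outputs $y_i=f(X_i)+\text{noise}$, where $f$ is a zero-mean Gaussian process with covariance $k$ and the $N=Mn$ noises are i.i.d. $\mathcal N(0,\sigma_\epsilon^2)$ and independent of $f$. Let $\mathcal X\subseteq\mathbb R^D$ be a set of prediction locations in which the design is infill: for each $x\in\mathcal X$ and $r>0$, the number of the $N$ inputs within distance $r$ of $x$ tends to infinity as $n\to\infty$. Let $\mu_{\rm full}(x_*)=k_*^\top C_\theta^{-1}y$ and $\sigma^2_{\rm full}(x_*)=k(x_*,x_*)-k_*^\top C_\theta^{-1}k_*$ be the predictions of the full GP from all $N$ observations, with $k_*=k(X,x_*)$, $C_\theta=k(X,X)+\sigma_\epsilon^2 I$. For $i,j\le M$ put $k_{i,*}=k(X_i,x_*)$, $C_{i}=k(X_i,X_i)+\sigma_\epsilon^2I$, $C_{ij}=k(X_i,X_j)$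 if $i\ne j$, $C_{ii}=C_i$, $\mu_i=k_{i,*}^\top C_i^{-1}y_i$, $[k_A]_i=k_{i,*}^\top C_i^{-1}k_{i,*}$, $[C_A]_{ij}=k_{i,*}^\top C_i^{-1}C_{ij}C_j^{-1}k_{j,*}$, and $R=\mathrm{diag}(C_A)^{-1}C_A$. DEC-NPAE. With $H=C_A$ and for $b=\mu$ and $b=k_A$, the agents run, from an initial vector $q^{(0)}$, the Jacobi over-relaxation (JOR) $q_i^{(s+1)}=(1-\omega)q_i^{(s)}+\frac{\omega}{h_{ii}}\bigl(b_i-\sum_{j\ne i}h_{ij}q_j^{(s)}\bigr)$; then, starting from $w_i^{(0)}=[k_A]_iq_i^{(s)}$, they run discrete-time average consensus (DAC) $w_i^{(t+1)}=w_i^{(t)}+\epsilon\sum_{j}a_{ij}(t)(w_j^{(t)}-w_i^{(t)})$ on undirected graphs $\mathcal G(t)$ with adjacency matrices $(a_{ij}(t))$; agent $i$ outputs the mean $Mw_{\mu,i}^{(t)}$ (from $b=\mu$) and the variance $k(x_*,x_*)-Mw_{\sigma^2,i}^{(t)}$ (from $b=k_A$). The method is called consistent if, for every $n\ge1$ and $x_*\in\mathcal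 X$, these outputs converge as all the iteration counts tend to infinity, to limits $\mu_{\mathcal A}(x_*),\sigma^2_{\mathcal A}(x_*)$ that are the same for all agents, and $\mathbb E|\mu_{\rm full}(x_*)-\mu_{\mathcal A}(x_*)|^2\to0$ and $\sigma^2_{\rm full}(x_*)-\sigma^2_{\mathcal A}(x_*)\to0$ as $n\to\infty$, for every $x_*\in\mathcal X$. Proposition. Assume that the communication graph is complete during the JOR and power-method iterations (agents use only values received from their neighbors), and that during the DAC iterations there is $\gamma\ge1$ such that for every $t\ge 0$ the union of $\mathcal G(t\gamma),\dots,\mathcal G((t+1)\gamma-1)$ is connected. Let $\Delta$ be the maximum number of neighbors of an agent over all DAC rounds, and let $\epsilon\in(0,1/\Delta)$ (any $\epsilon>0$ if $\Delta=0$). 1. If $0<\omega<2/M$, then DEC-NPAE is consistent for any JOR initializations. 2. If $\omega=\omega^\star=2/(\lambda_{\max}(R)+\lambda_{\min}(R))$, then the resulting method DEC-NPAE* is consistent for any JOR initializations. 3. Let $\omega^\star$ be computed by the power method $g^{(s+1)}=Ae^{(s)}$, $e^{(s+1)}=g^{(s+1)}/\|g^{(s+1)}\|_\infty$: first with $A=R$,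 giving $\hat\lambda=\|g\|_\infty$ after finitely many iterations, then with $A=R-\hat\lambda I$, giving $\hat\lambda'=\|g\|_\infty$, and $\hat\omega=2/(\hat\lambda+|\hat\lambda'-\hat\lambda|)$. If the two initial vectors have nonzero components along the eigenspaces of $R$ for $\lambda_{\max}(R)$ and $\lambda_{\min}(R)$ respectively, then $\hat\omega\to\omega^\star$ at every agent as the two iteration counts tend to infinity, and DEC-NPAE* executed with $\hat\omega$ is consistent for any JOR initializations. -/

import Mathlib

open MeasureTheory ProbabilityTheory Filter Topology
open scoped ENNReal Matrix

namespace DecGP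

noncomputable section

/-! ### Gaussian process regression -/

/-- Input locations. -/
abbrev Loc (D : ℕ) := EuclideanSpace ℝ (Fin D)

/-- Hyperparameters: length scales, signal standard deviation, noise standard deviation. -/
structure Hyper (D : ℕ) where
  ell : Fin D → ℝ
  sigF : ℝ
  sigE : ℝ
  ell_pos : ∀ d, 0 < ell d
  sigF_pos : 0 < sigF
  sigE_pos : 0 < sigE

variable {D M n : ℕ}

/-- Separable squared exponential covariance function. -/
def seKernel (θ : Hyper D) (x x' : Loc D) : ℝ :=
  θ.sigF ^ 2 * Real.exp (-∑ d, (x d - x' d) ^ 2 / θ.ell d ^ 2)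

/-- `C_θ = k(X, X) + σ_ε² I`, the covariance matrix of the noisy observations at `X`. -/
def covMat {ι : Type*} [DecidableEq ι] (θ : Hyper D) (X : ι → Loc D) : Matrix ι ι ℝ :=
  Matrix.of (fun a b => seKernel θ (X a) (X b)) + θ.sigE ^ 2 • (1 : Matrix ι ι ℝ)

/-- `k_* = k(X, x_*)`. -/
def kVec {ι : Type*} (θ : Hyper D) (X : ι → Loc D) (x : Loc D) : ι → ℝ :=
  fun a => seKernel θ (X a) x

/-- GP prediction mean `k_*ᵀ C_θ⁻¹ y`. -/
def postMean {ι : Type*} [Fintype ι] [DecidableEq ι] (θ : Hyper D) (X : ι → Loc D)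
    (y : ι → ℝ) (x : Loc D) : ℝ :=
  kVec θ X x ⬝ᵥ ((covMat θ X)⁻¹ *ᵥ y)

/-- GP prediction variance `k_** - k_*ᵀ C_θ⁻¹ k_*`. -/
def postVar {ι : Type*} [Fintype ι] [DecidableEq ι] (θ : Hyper D) (X : ι → Loc D)
    (x : Loc D) : ℝ :=
  seKernel θ x x - kVec θ X x ⬝ᵥ ((covMat θ X)⁻¹ *ᵥ kVec θ X x)

/-- Full GP prediction mean from the union of the local datasets of all `M` agents. -/
def fullMean (θ : Hyper D) (X : Fin M → Fin n → Loc D) (y : Fin M → Fin n → ℝ)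
    (x : Loc D) : ℝ :=
  postMean θ (fun p : Fin M × Fin n => X p.1 p.2) (fun p => y p.1 p.2) x

/-- Full GP prediction variance. -/
def fullVar (θ : Hyper D) (X : Fin M → Fin n → Loc D) (x : Loc D) : ℝ :=
  postVar θ (fun p : Fin M × Fin n => X p.1 p.2) x

/-! ### Local quantities of the nested pointwise aggregation of experts (NPAE) -/

/-- Local prediction means `μ_i(x_*)`. -/
def localMean (θ : Hyper D) (X : Fin M → Fin n → Loc D) (y : Fin M → Fin n → ℝ)
    (x : Loc D) : Fin M → ℝ :=
  fun i => postMean θ (X i) (y i) x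

/-- Cross-covariances `[k_A]_i = k_{i,*}ᵀ C_{θ,i}⁻¹ k_{i,*}`. -/
def crossVec (θ : Hyper D) (X : Fin M → Fin n → Loc D) (x : Loc D) : Fin M → ℝ :=
  fun i => kVec θ (X i) x ⬝ᵥ ((covMat θ (X i))⁻¹ *ᵥ kVec θ (X i) x)

/-- `C_{θ,ij}`, the covariance matrix of the observation vectors of agents `i` and `j`; the
measurement noise is independent between observations, so it contributes only when `i = j`. -/
def pairCov (θ : Hyper D) (X : Fin M → Fin n → Loc D) (i j : Fin M) :
    Matrix (Fin n) (Fin n) ℝ :=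
  Matrix.of (fun a b => seKernel θ (X i a) (X j b)) +
    (if i = j then θ.sigE ^ 2 • (1 : Matrix (Fin n) (Fin n) ℝ) else 0)

/-- `[C_{θ,A}]_{ij} = k_{i,*}ᵀ C_{θ,i}⁻¹ C_{θ,ij} C_{θ,j}⁻¹ k_{j,*}`. -/
def aggCov (θ : Hyper D) (X : Fin M → Fin n → Loc D) (x : Loc D) : Matrix (Fin M) (Fin M) ℝ :=
  Matrix.of fun i j =>
    kVec θ (X i) x ⬝ᵥ
      (((covMat θ (X i))⁻¹ * pairCov θ X i j * (covMat θ (X j))⁻¹) *ᵥ kVec θ (X j) x)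

/-- `R = diag(C_{θ,A})⁻¹ C_{θ,A}`. -/
def scaledCov (θ : Hyper D) (X : Fin M → Fin n → Loc D) (x : Loc D) :
    Matrix (Fin M) (Fin M) ℝ :=
  Matrix.of fun i j => (aggCov θ X x i i)⁻¹ * aggCov θ X x i j

/-! ### Networks -/

/-- Every agent can communicate with every other agent. -/
def StronglyComplete (G : SimpleGraph (Fin M)) : Prop := ∀ i j, i ≠ j → G.Adj i j

/-- For some `γ ≥ 1`, the union of the graphs over each window `tγ, …, (t+1)γ - 1` is connected. -/
def RepeatedlyConnected (G : ℕ → SimpleGraph (Fin M)) : Prop :=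
  ∃ γ : ℕ, 0 < γ ∧ ∀ t : ℕ, (⨆ k : Fin γ, G (t * γ + k)).Connected

open Classical in
/-- Maximum number of neighbors in the time-varying graph, over all agents and all times. -/
def maxNeighbors (G : ℕ → SimpleGraph (Fin M)) : ℕ := ⨆ t, (G t).maxDegree

/-! ### Iterative schemes -/

open Classical in
/-- Jacobi over-relaxation for `H q = b` from `q0`. Agent `i` holds row `i` of `H`, the entry `b i`
and its relaxation factor `ω i`, and receives `q j` from its neighbors only. -/
def jor (G : SimpleGraph (Fin M)) (ω : Fin M → ℝ) (H : Matrix (Fin M) (Fin M) ℝ)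
    (b q0 : Fin M → ℝ) : ℕ → Fin M → ℝ
  | 0 => q0
  | s + 1 => fun i =>
      (1 - ω i) * jor G ω H b q0 s i +
        ω i / H i i * (b i - ∑ j, if G.Adj i j then H i j * jor G ω H b q0 s j else 0)

open Classical in
/-- Discrete-time average consensus on the time-varying graph `G` from `w0`. -/
def dac (G : ℕ → SimpleGraph (Fin M)) (ε : ℝ) (w0 : Fin M → ℝ) : ℕ → Fin M → ℝ
  | 0 => w0
  | t + 1 => fun i =>
      dac G ε w0 t i +
        ε * ∑ j, if (G t).Adj i j then dac G ε w0 t j - dac G ε w0 t i else 0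

open Classical in
/-- The vector `g = A e` as seen by agent `i`: agent `j` computes `g_j = row_j(A) · e` from its own
copy of `e`, and agent `i` knows its own entry and those received from its neighbors. -/
def pmRecv (G : SimpleGraph (Fin M)) (A : Matrix (Fin M) (Fin M) ℝ) (e : Fin M → Fin M → ℝ)
    (i : Fin M) : Fin M → ℝ :=
  fun j => if i = j ∨ G.Adj i j then A j ⬝ᵥ e j else 0

/-- Power method: `pmVec … s i` is the copy of `e⁽ˢ⁾` held by agent `i`. The norm on
`Fin M → ℝ` is the infinity norm. -/
def pmVec (G : SimpleGraph (Fin M)) (A : Matrix (Fin M) (Fin M) ℝ) (e0 : Fin M → ℝ) :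
    ℕ → Fin M → Fin M → ℝ
  | 0 => fun _ => e0
  | s + 1 => fun i =>
      ‖pmRecv G A (pmVec G A e0 s) i‖⁻¹ • pmRecv G A (pmVec G A e0 s) i

/-- Eigenvalue estimate `‖g⁽ˢ⁺¹⁾‖_∞` of agent `i`. -/
def pmEig (G : SimpleGraph (Fin M)) (A : Matrix (Fin M) (Fin M) ℝ) (e0 : Fin M → ℝ)
    (s : ℕ) (i : Fin M) : ℝ :=
  ‖pmRecv G A (pmVec G A e0 s) i‖

/-- Relaxation factor computed by agent `i` from `s₁` power iterations on `R` (started at `e0`),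
giving `λ`, followed by `s₂` power iterations on the spectral shift `R - λ I` (started at `f0`),
giving `λ'`: the value `2 / (λ + |λ' - λ|)`. -/
def pmOmega (G : SimpleGraph (Fin M)) (R : Matrix (Fin M) (Fin M) ℝ) (e0 f0 : Fin M → ℝ)
    (s₁ s₂ : ℕ) (i : Fin M) : ℝ :=
  2 / (pmEig G R e0 s₁ i +
    |pmEig G (R - Matrix.diagonal (pmEig G R e0 s₁)) f0 s₂ i - pmEig G R e0 s₁ i|)

/-- Largest eigenvalue of a matrix with real spectrum. -/
def eigMax (R : Matrix (Fin M) (Fin M) ℝ) : ℝ := sSup (spectrum ℝ R)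

/-- Smallest eigenvalue of a matrix with real spectrum. -/
def eigMin (R : Matrix (Fin M) (Fin M) ℝ) : ℝ := sInf (spectrum ℝ R)

/-- Optimal relaxation factor `ω⋆ = 2 / (λ_max(R) + λ_min(R))`. -/
def omegaStar (R : Matrix (Fin M) (Fin M) ℝ) : ℝ := 2 / (eigMax R + eigMin R)

/-- `e` has a nonzero component along the `lam`-eigenspace of the (diagonalizable) matrix `R`, that
is, some left eigenvector of `R` for `lam` is not orthogonal to `e`. -/
def HasComponent (R : Matrix (Fin M) (Fin M) ℝ) (lam : ℝ) (e : Fin M → ℝ) : Prop :=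
  ∃ u : Fin M → ℝ, u ᵥ* R = lam • u ∧ u ⬝ᵥ e ≠ 0

/-! ### DEC-NPAE -/

/-- Prediction mean of agent `i` in DEC-NPAE after `s` JOR rounds on the graph `Gc` with relaxation
factors `ω`, started at `q0`, and then `t` consensus rounds on the time-varying graph `Gd`. -/
def decMean (θ : Hyper D) (X : Fin M → Fin n → Loc D) (y : Fin M → Fin n → ℝ) (x : Loc D)
    (Gc : SimpleGraph (Fin M)) (Gd : ℕ → SimpleGraph (Fin M)) (ω : Fin M → ℝ) (ε : ℝ)
    (q0 : Fin M → ℝ) (s t : ℕ) (i : Fin M) : ℝ :=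
  M * dac Gd ε
    (fun j => crossVec θ X x j * jor Gc ω (aggCov θ X x) (localMean θ X y x) q0 s j) t i

/-- Prediction variance of agent `i` in DEC-NPAE after `s` JOR and `t` consensus rounds. -/
def decVar (θ : Hyper D) (X : Fin M → Fin n → Loc D) (x : Loc D)
    (Gc : SimpleGraph (Fin M)) (Gd : ℕ → SimpleGraph (Fin M)) (ω : Fin M → ℝ) (ε : ℝ)
    (q0 : Fin M → ℝ) (s t : ℕ) (i : Fin M) : ℝ :=
  seKernel θ x x - M * dac Gd ε
    (fun j => crossVec θ X x j * jor Gc ω (aggCov θ X x) (crossVec θ X x) q0 s j) t i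

/-! ### Data model and consistency -/

variable {Ω : Type*} [MeasurableSpace Ω]

/-- `f` is a zero-mean Gaussian process with the squared exponential covariance; for each local
sample size `n`, the `M * n` measurement errors `e n i a` are i.i.d. `N(0, σ_ε²)` and independent
of `f`. -/
structure IsGPModel (θ : Hyper D) (P : Measure Ω) (f : Loc D → Ω → ℝ)
    (e : (n : ℕ) → Fin M → Fin n → Ω → ℝ) : Prop where
  gaussian : IsGaussianProcess f P
  mean_zero : ∀ x, P[f x] = 0
  cov_eq : ∀ x x', cov[f x, f x'; P] = seKernel θ x x'
  noise_law : ∀ n i a, HasLaw (e n i a) (gaussianReal 0 (θ.sigE ^ 2).toNNReal) P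
  noise_indep : ∀ n, iIndepFun (fun (p : Fin M × Fin n) (w : Ω) => e n p.1 p.2 w) P
  indep : ∀ n, IndepFun (fun (w : Ω) (x : Loc D) => f x w)
    (fun (w : Ω) (p : Fin M × Fin n) => e n p.1 p.2 w) P

/-- Observations `y = f(x) + noise` at the design `X`. -/
def obs (X : (n : ℕ) → Fin M → Fin n → Loc D) (f : Loc D → Ω → ℝ)
    (e : (n : ℕ) → Fin M → Fin n → Ω → ℝ) (n : ℕ) (w : Ω) : Fin M → Fin n → ℝ :=
  fun i a => f (X n i a) w + e n i a w

/-- Infill design on `S`: the number of observed inputs, over all agents, in each neighborhood of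
each point of `S` tends to infinity. -/
def IsInfill (X : (n : ℕ) → Fin M → Fin n → Loc D) (S : Set (Loc D)) : Prop :=
  ∀ x ∈ S, ∀ r > 0,
    Tendsto (fun n => Nat.card {p : Fin M × Fin n // dist (X n p.1 p.2) x < r}) atTop atTop

/-- Consistency on `S` of an aggregation method with prediction mean `mA` and variance `vA`, as the
number `n` of observations per agent tends to infinity. The prediction means are random variables,
and their difference is required to tend to zero in mean square. -/
def IsConsistent (θ : Hyper D) (P : Measure Ω) (S : Set (Loc D))
    (X : (n : ℕ) → Fin M → Fin n → Loc D) (f : Loc D → Ω → ℝ)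
    (e : (n : ℕ) → Fin M → Fin n → Ω → ℝ)
    (mA : ℕ → Loc D → Ω → ℝ) (vA : ℕ → Loc D → ℝ) : Prop :=
  ∀ x ∈ S,
    Tendsto (fun n => eLpNorm (fun w => fullMean θ (X n) (obs X f e n w) x - mA n x w) 2 P)
      atTop (𝓝 0) ∧
    Tendsto (fun n => fullVar θ (X n) x - vA n x) atTop (𝓝 0)

/-- Convergence of a decentralized iterative method to the prediction mean `mA` and variance `vA`:
for each nonempty local sample size `n`, each location in `S` and each outcome, the iterates of
every agent converge as the iteration counts `c` tend to infinity. -/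
def ConvergesTo {κ : Type*} [Preorder κ] (S : Set (Loc D))
    (mIter : ℕ → Loc D → Ω → κ → Fin M → ℝ) (vIter : ℕ → Loc D → κ → Fin M → ℝ)
    (mA : ℕ → Loc D → Ω → ℝ) (vA : ℕ → Loc D → ℝ) : Prop :=
  ∀ n, 1 ≤ n → ∀ x ∈ S, ∀ i,
    (∀ w, Tendsto (fun c => mIter n x w c i) atTop (𝓝 (mA n x w))) ∧
    Tendsto (fun c => vIter n x c i) atTop (𝓝 (vA n x))

/-- A decentralized iterative method is consistent if its iterates converge, to the same values at
all agents, and the resulting prediction mean and variance are consistent. -/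
def IsConsistentMethod {κ : Type*} [Preorder κ] (θ : Hyper D) (P : Measure Ω) (S : Set (Loc D))
    (X : (n : ℕ) → Fin M → Fin n → Loc D) (f : Loc D → Ω → ℝ)
    (e : (n : ℕ) → Fin M → Fin n → Ω → ℝ)
    (mIter : ℕ → Loc D → Ω → κ → Fin M → ℝ) (vIter : ℕ → Loc D → κ → Fin M → ℝ) : Prop :=
  ∃ (mA : ℕ → Loc D → Ω → ℝ) (vA : ℕ → Loc D → ℝ),
    ConvergesTo S mIter vIter mA vA ∧ IsConsistent θ P S X f e mA vA

end

end DecGP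

/-! The argument separates the limit of the iterations at fixed `n` from the statistics as `n`
grows.

Iterations. The matrix `R` is similar to a positive definite matrix with unit diagonal, so it has an
eigenbasis with positive eigenvalues of sum `M` (`exists_eigenbasis_diagScaled`). JOR multiplies the
error by `I - ωR`, hence converges when every `ωλ` lies in `(0, 2)`. This holds for `ω < 2 / M`
because `λ ≤ M`, and for `ω⋆` because `λ < λ_max + λ_min`. Consensus preserves the sum and decreases
the sum of squares by a multiple of the squared edge differences, which therefore vanish; repeated
connectivity turns this into convergence to the average (`tendsto_dac`). The counts grow jointly,
and in the third claim `ω` moves with them, so each limit is proved along a filter with varying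
parameters. The common limit is `k_Aᵀ C_A⁻¹ b`, the NPAE prediction.

Statistics. With `W` the matrix of expert weights, `k_A = Wᵀ k_*`, `μ = Wᵀ y` and `C_A = Wᵀ C W`.
NPAE is thus the best linear predictor from the local means, while the full GP is the best from all
observations. By completing the square, their mean square distance equals the difference of their
variances (`gapWeights_quadratic`). That difference lies between zero and the NPAE variance, which
is at most the variance of any single agent. Under infill, some agent has many inputs near `x_*`,
and averaging its nearby observations makes its variance small (`tendsto_npaeVar`). -/

namespace DecGP

/-! ### Spectrum of the diagonally scaled matrix -/

/-- Row scaling of a matrix by the inverse of its diagonal. -/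
noncomputable def diagScaled {M : ℕ} (H : Matrix (Fin M) (Fin M) ℝ) : Matrix (Fin M) (Fin M) ℝ :=
  Matrix.of fun i j => (H i i)⁻¹ * H i j

theorem spectrum_eq_range_of_eigenbasis {M : ℕ} {R : Matrix (Fin M) (Fin M) ℝ}
    (b : Module.Basis (Fin M) ℝ (Fin M → ℝ)) (lam : Fin M → ℝ)
    (hb : ∀ k, R *ᵥ b k = lam k • b k) : spectrum ℝ R = Set.range lam := by
  have h : (Matrix.diagonal lam).toLin b b = R.toLin' := by
    refine b.ext fun k => ?_
    rw [Matrix.toLin_self, Matrix.toLin'_apply, hb, Finset.sum_eq_single k]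
    · simp
    · intro j _ hj
      simp [Matrix.diagonal_apply_ne _ hj]
    · simp
  rw [← Matrix.spectrum_toLin', ← h, Matrix.spectrum_toLin, spectrum_diagonal]

/-- `R` is not symmetric, but with `E = diag(H)^(-1/2)` one has `R E = E (E H E)`, so `E` carries an
orthonormal eigenbasis of the positive definite `E H E` to an eigenbasis of `R`. The eigenvalues sum
to the trace of `E H E`, whose diagonal entries are all 1. -/
theorem exists_eigenbasis_diagScaled {M : ℕ} {H : Matrix (Fin M) (Fin M) ℝ} (hH : H.PosDef) :
    ∃ (b : Module.Basis (Fin M) ℝ (Fin M → ℝ)) (lam : Fin M → ℝ),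
      (∀ k, diagScaled H *ᵥ b k = lam k • b k) ∧ (∀ k, 0 < lam k) ∧ ∑ k, lam k = M := by
  set d : Fin M → ℝ := fun i => √(H i i) with hd
  have hHii : ∀ i, 0 < H i i := fun i => hH.diag_pos
  have hd0 : ∀ i, d i ≠ 0 := fun i => (Real.sqrt_pos.2 (hHii i)).ne'
  have hdd : ∀ i, d i * d i = H i i := fun i => Real.mul_self_sqrt (hHii i).le
  have h1 : Matrix.diagonal d * Matrix.diagonal (fun i => (d i)⁻¹) = 1 := by
    rw [Matrix.diagonal_mul_diagonal]
    simp [hd0]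
  have h2 : Matrix.diagonal (fun i => (d i)⁻¹) * Matrix.diagonal d = 1 := by
    rw [Matrix.diagonal_mul_diagonal]
    simp [hd0]
  set E := Matrix.diagonal (fun i => (d i)⁻¹) with hE
  have hEt : Eᴴ = E := by
    rw [hE, Matrix.diagonal_conjTranspose]; simp
  have hB : (E * H * E).PosDef := by
    have := hH.conjTranspose_mul_mul_same (B := E) (fun x y hxy => by
      have := congrArg (fun z => Matrix.diagonal d *ᵥ z) hxy
      simpa [Matrix.mulVec_mulVec, h1] using this)
    rwa [hEt] at this
  have hR : diagScaled H * E = E * (E * H * E) := by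
    ext i j
    rw [hE]
    simp only [Matrix.diagonal_mul, Matrix.mul_diagonal, diagScaled, Matrix.of_apply, ← hdd i,
      mul_inv]
    ring
  let b := (hB.1.eigenvectorBasis.toBasis.map (WithLp.linearEquiv 2 ℝ (Fin M → ℝ))).map
    (Matrix.toLin'OfInv h1 h2)
  refine ⟨b, hB.1.eigenvalues, fun k => ?_, hB.eigenvalues_pos, ?_⟩
  · have hbk : b k = E *ᵥ (hB.1.eigenvectorBasis k).ofLp := by
      simp [b, Matrix.toLin'OfInv]
    rw [hbk, Matrix.mulVec_mulVec, hR, ← Matrix.mulVec_mulVec, hB.1.mulVec_eigenvectorBasis,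
      Matrix.mulVec_smul]
  · have := hB.1.trace_eq_sum_eigenvalues
    simp only [RCLike.ofReal_real_eq_id, id] at this
    rw [← this, Matrix.trace]
    rw [hE]
    simp only [Matrix.diagonal_mul, Matrix.mul_diagonal, Matrix.diag_apply, ← hdd]
    rw [Finset.sum_congr rfl (g := fun _ => (1 : ℝ))]
    · simp
    · intro i _
      field_simp [hd0 i]

/-- The base moves with the exponent, as it does when the relaxation factor or the spectral shift is
itself being iterated; a fixed `ρ < 1` eventually dominates it. -/
theorem tendsto_pow_zero_of_abs_lt_one {κ : Type*} {l : Filter κ} {r : κ → ℝ} {r0 : ℝ} {s : κ → ℕ}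
    (hr : Tendsto r l (𝓝 r0)) (h0 : |r0| < 1) (hs : Tendsto s l atTop) :
    Tendsto (fun c => r c ^ s c) l (𝓝 0) := by
  obtain ⟨ρ, h1, h2⟩ := exists_between h0
  have hρ : 0 ≤ ρ := (abs_nonneg _).trans h1.le
  refine squeeze_zero_norm' ?_ ((tendsto_pow_atTop_nhds_zero_of_lt_one hρ h2).comp hs)
  filter_upwards [hr.abs.eventually_lt_const h1] with c hc
  rw [norm_pow, Real.norm_eq_abs]
  exact pow_le_pow_left₀ (abs_nonneg _) hc.le _

/-! ### Jacobi over-relaxation -/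

section Jor

variable {M : ℕ} {G : SimpleGraph (Fin M)} {H : Matrix (Fin M) (Fin M) ℝ}

theorem jor_succ_sub (hG : StronglyComplete G) (hH : ∀ i, H i i ≠ 0) (ω : ℝ)
    {b q : Fin M → ℝ} (hq : H *ᵥ q = b) (q0 : Fin M → ℝ) (s : ℕ) :
    jor G (fun _ => ω) H b q0 (s + 1) - q =
      (jor G (fun _ => ω) H b q0 s - q) -
        ω • (diagScaled H *ᵥ (jor G (fun _ => ω) H b q0 s - q)) := by
  classical
  ext i
  set z := jor G (fun _ => ω) H b q0 s with hz
  -- Completeness of the graph makes the neighbor sum the full off-diagonal sum.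
  have h1 : (∑ j, if G.Adj i j then H i j * z j else 0) = ∑ j, H i j * z j - H i i * z i := by
    rw [← Finset.sum_erase_eq_sub (Finset.mem_univ i), ← Finset.filter_ne, Finset.sum_filter]
    refine Finset.sum_congr rfl fun j _ => ?_
    by_cases hij : i = j
    · subst hij; simp
    · simp [hG i j hij, hij]
  have h2 : (diagScaled H *ᵥ (z - q)) i = (H i i)⁻¹ * (∑ j, H i j * z j - b i) := by
    rw [← hq]
    simp only [Matrix.mulVec, dotProduct, diagScaled, Matrix.of_apply, Pi.sub_apply, mul_sub,
      Finset.sum_sub_distrib, Finset.mul_sum, mul_assoc]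
  simp only [Pi.sub_apply, Pi.smul_apply, smul_eq_mul, h2, jor]
  rw [← hz]
  have e : ∀ (S : ℝ), S = ∑ j, H i j * z j - H i i * z i →
      (1 - ω) * z i + ω / H i i * (b i - S) - q i =
      z i - q i - ω * ((H i i)⁻¹ * (∑ j, H i j * z j - b i)) := by
    intro S hS
    rw [hS]
    field_simp [hH i]
    ring
  apply e
  convert h1

theorem jor_sub_eq_sum (hG : StronglyComplete G) (hH : ∀ i, H i i ≠ 0)
    (v : Module.Basis (Fin M) ℝ (Fin M → ℝ)) {lam : Fin M → ℝ}
    (hv : ∀ k, diagScaled H *ᵥ v k = lam k • v k) (ω : ℝ)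
    {b q : Fin M → ℝ} (hq : H *ᵥ q = b) (q0 : Fin M → ℝ) (s : ℕ) :
    jor G (fun _ => ω) H b q0 s - q =
      ∑ k, (v.repr (q0 - q) k * (1 - ω * lam k) ^ s) • v k := by
  induction s with
  | zero => simpa [jor] using (v.sum_repr (q0 - q)).symm
  | succ s ih =>
    rw [jor_succ_sub hG hH ω hq, ih, Matrix.mulVec_sum, Finset.smul_sum, ← Finset.sum_sub_distrib]
    refine Finset.sum_congr rfl fun k _ => ?_
    rw [Matrix.mulVec_smul, hv, smul_smul, smul_smul, ← sub_smul]
    ring_nf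

/-- Convergence of JOR with a relaxation factor that may vary along the filter. -/
theorem tendsto_jor (hG : StronglyComplete G) (hH : ∀ i, H i i ≠ 0)
    (v : Module.Basis (Fin M) ℝ (Fin M → ℝ)) {lam : Fin M → ℝ}
    (hv : ∀ k, diagScaled H *ᵥ v k = lam k • v k) {b q : Fin M → ℝ} (hq : H *ᵥ q = b)
    (q0 : Fin M → ℝ) {κ : Type*} {l : Filter κ} {ω : κ → ℝ} {ω0 : ℝ} {s : κ → ℕ}
    (hω : Tendsto ω l (𝓝 ω0)) (hs : Tendsto s l atTop) (h0 : ∀ k, 0 < ω0 * lam k)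
    (h2 : ∀ k, ω0 * lam k < 2) :
    Tendsto (fun c => jor G (fun _ => ω c) H b q0 (s c)) l (𝓝 q) := by
  have h : Tendsto (fun c => jor G (fun _ => ω c) H b q0 (s c) - q) l (𝓝 0) := by
    simp_rw [jor_sub_eq_sum hG hH v hv _ hq]
    have : (0 : Fin M → ℝ) = ∑ k, (v.repr (q0 - q) k * 0) • v k := by simp
    rw [this]
    refine tendsto_finsetSum _ fun k _ => Tendsto.smul_const ?_ _
    refine Tendsto.const_mul _ (tendsto_pow_zero_of_abs_lt_one (r0 := 1 - ω0 * lam k) ?_ ?_ hs)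
    · exact (hω.mul_const _).const_sub _
    · rw [abs_lt]; constructor <;> linarith [h0 k, h2 k]
  simpa using h.add_const q

end Jor

/-! ### Power method and the optimal relaxation factor -/

section Power

variable {M : ℕ} {G : SimpleGraph (Fin M)}

theorem pmRecv_const (hG : StronglyComplete G) (A : Matrix (Fin M) (Fin M) ℝ) (e : Fin M → ℝ)
    (i : Fin M) : pmRecv G A (fun _ => e) i = A *ᵥ e := by
  ext j
  have : i = j ∨ G.Adj i j := (eq_or_ne i j).imp_right (hG i j)
  simp [pmRecv, this, Matrix.mulVec]

/-- All copies agree on a complete graph and the normalizations telescope. The formula starts at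
step one because the initial vector is not normalized; if the iterate vanishes, both sides are zero
by `0⁻¹ = 0`. -/
theorem pmVec_succ_eq (hG : StronglyComplete G) (A : Matrix (Fin M) (Fin M) ℝ) (e0 : Fin M → ℝ)
    (s : ℕ) : pmVec G A e0 (s + 1) = fun _ => ‖A ^ (s + 1) *ᵥ e0‖⁻¹ • (A ^ (s + 1) *ᵥ e0) := by
  induction s with
  | zero =>
    funext i
    simp only [pmVec]
    rw [pmRecv_const hG]
    simp
  | succ s ih =>
    funext i
    simp only [pmVec] at ih ⊢
    rw [ih, pmRecv_const hG, Matrix.mulVec_smul, Matrix.mulVec_mulVec, ← pow_succ' A]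
    by_cases h : A ^ (s + 1) *ᵥ e0 = 0
    · have h' : A ^ (s + 1 + 1) *ᵥ e0 = 0 := by
        rw [pow_succ', ← Matrix.mulVec_mulVec, h, Matrix.mulVec_zero]
      simp [h']
    · have h1 : ‖A ^ (s + 1) *ᵥ e0‖ ≠ 0 := norm_ne_zero_iff.2 h
      rw [norm_smul, norm_inv, norm_norm, smul_smul, mul_inv, inv_inv, mul_assoc, mul_comm,
        mul_assoc, inv_mul_cancel₀ h1, mul_one]

theorem pmEig_succ_eq (hG : StronglyComplete G) (A : Matrix (Fin M) (Fin M) ℝ) (e0 : Fin M → ℝ)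
    (s : ℕ) (i : Fin M) :
    pmEig G A e0 (s + 1) i = ‖A ^ (s + 1) *ᵥ e0‖⁻¹ * ‖A ^ (s + 2) *ᵥ e0‖ := by
  rw [pmEig, pmVec_succ_eq hG, pmRecv_const hG, Matrix.mulVec_smul, Matrix.mulVec_mulVec,
    ← pow_succ' A, norm_smul, norm_inv, norm_norm]

theorem pmEig_eq_pmEig (hG : StronglyComplete G) (A : Matrix (Fin M) (Fin M) ℝ) (e0 : Fin M → ℝ)
    (s : ℕ) (i j : Fin M) : pmEig G A e0 s i = pmEig G A e0 s j := by
  cases s with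
  | zero => simp only [pmEig, pmVec, pmRecv_const hG]
  | succ s => rw [pmEig_succ_eq hG, pmEig_succ_eq hG]

theorem pow_mulVec_eq_sum (v : Module.Basis (Fin M) ℝ (Fin M → ℝ)) {lam : Fin M → ℝ}
    {A : Matrix (Fin M) (Fin M) ℝ} (hv : ∀ k, A *ᵥ v k = lam k • v k) (e : Fin M → ℝ) (s : ℕ) :
    A ^ s *ᵥ e = ∑ k, (v.repr e k * lam k ^ s) • v k := by
  induction s with
  | zero => simp [v.sum_repr]
  | succ s ih =>
    rw [pow_succ', ← Matrix.mulVec_mulVec, ih, Matrix.mulVec_sum]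
    refine Finset.sum_congr rfl fun k _ => ?_
    rw [Matrix.mulVec_smul, hv, smul_smul]
    ring_nf

/-- A nonzero component along an eigenspace is a nonzero coordinate in an eigenbasis. -/
theorem HasComponent.exists_repr_ne_zero {R : Matrix (Fin M) (Fin M) ℝ} {μ : ℝ} {e : Fin M → ℝ}
    (h : HasComponent R μ e) (v : Module.Basis (Fin M) ℝ (Fin M → ℝ)) {lam : Fin M → ℝ}
    (hv : ∀ k, R *ᵥ v k = lam k • v k) : ∃ k, lam k = μ ∧ v.repr e k ≠ 0 := by
  obtain ⟨u, hu, hue⟩ := h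
  by_contra! hcon
  apply hue
  rw [← v.sum_repr e, dotProduct_sum]
  refine Finset.sum_eq_zero fun k _ => ?_
  by_cases hk : lam k = μ
  · simp [hcon k hk]
  -- Left and right eigenvectors for distinct eigenvalues are orthogonal.
  · have h1 : u ⬝ᵥ (R *ᵥ v k) = μ * (u ⬝ᵥ v k) := by
      rw [Matrix.dotProduct_mulVec, hu, smul_dotProduct, smul_eq_mul]
    rw [hv, dotProduct_smul, smul_eq_mul] at h1
    have h2 : (lam k - μ) * (u ⬝ᵥ v k) = 0 := by linarith
    rw [dotProduct_smul, (mul_eq_zero.1 h2).resolve_left (sub_ne_zero.2 hk), smul_zero]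

/-- Power iteration on `A c → A₀` (with common eigenbasis) converges to the modulus of a dominant
eigenvalue of `A₀` along which the initial vector has a component. -/
theorem tendsto_pmEig (hG : StronglyComplete G) (v : Module.Basis (Fin M) ℝ (Fin M → ℝ))
    {κ : Type*} {l : Filter κ} {A : κ → Matrix (Fin M) (Fin M) ℝ} {ev : κ → Fin M → ℝ}
    {ev0 : Fin M → ℝ} (hv : ∀ c k, A c *ᵥ v k = ev c k • v k)
    (hev : ∀ k, Tendsto (fun c => ev c k) l (𝓝 (ev0 k))) {k0 : Fin M} {e0 : Fin M → ℝ}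
    (hk0 : v.repr e0 k0 ≠ 0) (hne : ev0 k0 ≠ 0)
    (hdom : ∀ k, (∀ c, ev c k = ev c k0) ∨ |ev0 k| < |ev0 k0|)
    {s : κ → ℕ} (hs : Tendsto s l atTop) (i : Fin M) :
    Tendsto (fun c => pmEig G (A c) e0 (s c) i) l (𝓝 |ev0 k0|) := by
  classical
  -- After division by `ev c k0 ^ t`, the terms in `J` are constant and the others decay, so the
  -- rescaled iterates tend to `w`. Exact equality of eigenvalues for every `c` matters in `J`:
  -- powers of a ratio that merely tends to 1 have no determined limit.
  let J : Finset (Fin M) := Finset.univ.filter fun k => ∀ c, ev c k = ev c k0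
  let w : Fin M → ℝ := ∑ k ∈ J, v.repr e0 k • v k
  let W : κ → ℕ → Fin M → ℝ := fun c t => ∑ k, (v.repr e0 k * (ev c k / ev c k0) ^ t) • v k
  have hw : w ≠ 0 := by
    intro h
    have h1 := congrArg (fun z => v.repr z k0) h
    simp only [w, map_sum, map_smul, Module.Basis.repr_self, map_zero, Finsupp.coe_zero,
      Pi.zero_apply] at h1
    rw [Finsupp.finsetSum_apply, Finset.sum_eq_single k0] at h1
    · simp at h1; exact hk0 h1
    · intro k _ hk
      simp [hk]
    · intro h2
      exact absurd (by simp [J]) h2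
  have hev0 : ∀ᶠ c in l, ev c k0 ≠ 0 := (hev k0).eventually_ne hne
  have hW : ∀ t : κ → ℕ, Tendsto t l atTop → Tendsto (fun c => W c (t c)) l (𝓝 w) := by
    intro t ht
    have : w = ∑ k, (v.repr e0 k * if k ∈ J then 1 else 0) • v k := by
      simp [w, Finset.sum_ite_mem, ite_smul, mul_ite]
    rw [this]
    refine tendsto_finsetSum _ fun k _ => Tendsto.smul_const (Tendsto.const_mul _ ?_) _
    by_cases hk : k ∈ J
    · rw [if_pos hk]
      refine (tendsto_const_nhds (x := (1 : ℝ))).congr' ?_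
      filter_upwards [hev0] with c hc
      rw [(Finset.mem_filter.1 hk).2 c, div_self hc, one_pow]
    · rw [if_neg hk]
      refine tendsto_pow_zero_of_abs_lt_one ((hev k).div (hev k0) hne) ?_ ht
      have := (hdom k).resolve_left (by simpa [J] using hk)
      rwa [abs_div, div_lt_one (abs_pos.2 hne)]
  have hpow : ∀ c, ev c k0 ≠ 0 → ∀ t, A c ^ t *ᵥ e0 = ev c k0 ^ t • W c t := by
    intro c hc t
    rw [pow_mulVec_eq_sum v (hv c), Finset.smul_sum]
    refine Finset.sum_congr rfl fun k _ => ?_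
    rw [smul_smul, div_pow]
    field_simp
  have hs1 : Tendsto (fun c => s c + 1) l atTop := (tendsto_add_atTop_nat 1).comp hs
  have hlim : Tendsto (fun c => ‖W c (s c)‖⁻¹ * (|ev c k0| * ‖W c (s c + 1)‖)) l
      (𝓝 (‖w‖⁻¹ * (|ev0 k0| * ‖w‖))) :=
    ((hW s hs).norm.inv₀ (norm_ne_zero_iff.2 hw)).mul ((hev k0).abs.mul (hW _ hs1).norm)
  have : ‖w‖⁻¹ * (|ev0 k0| * ‖w‖) = |ev0 k0| := by
    field_simp [norm_ne_zero_iff.2 hw]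
  rw [this] at hlim
  refine hlim.congr' ?_
  filter_upwards [hev0, hs.eventually_ge_atTop 1] with c hc hsc
  obtain ⟨t, ht⟩ := Nat.exists_eq_add_of_le' hsc
  rw [ht, pmEig_succ_eq hG, hpow c hc, hpow c hc, norm_smul, norm_smul, norm_pow, norm_pow,
    Real.norm_eq_abs, pow_succ _ (t + 1)]
  have : |ev c k0| ^ (t + 1) ≠ 0 := pow_ne_zero _ (abs_ne_zero.2 hc)
  rw [mul_inv]
  field_simp

/-- Serves the degenerate case in which all eigenvalues of `R` coincide. The shifted matrix is then
a scalar tending to zero, so `tendsto_pmEig`, which needs a nonzero limiting eigenvalue, does not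
apply. -/
theorem pmEig_smul_one_le (hG : StronglyComplete G) (a : ℝ) (e0 : Fin M → ℝ) (s : ℕ)
    (i : Fin M) : pmEig G (a • (1 : Matrix (Fin M) (Fin M) ℝ)) e0 (s + 1) i ≤ |a| := by
  rw [pmEig_succ_eq hG, pow_succ' _ (s + 1), ← Matrix.mulVec_mulVec, Matrix.smul_mulVec,
    Matrix.one_mulVec, norm_smul, Real.norm_eq_abs]
  set x := ‖(a • (1 : Matrix (Fin M) (Fin M) ℝ)) ^ (s + 1) *ᵥ e0‖
  by_cases hx : x = 0
  · simp [hx]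
  · field_simp; exact le_rfl

/-- The relaxation factor computed by power iteration converges to the optimal one. -/
theorem tendsto_pmOmega (hG : StronglyComplete G) {R : Matrix (Fin M) (Fin M) ℝ}
    (v : Module.Basis (Fin M) ℝ (Fin M → ℝ)) {lam : Fin M → ℝ}
    (hv : ∀ k, R *ᵥ v k = lam k • v k) (hlam : ∀ k, 0 < lam k) {e0 f0 : Fin M → ℝ}
    (he : HasComponent R (eigMax R) e0) (hf : HasComponent R (eigMin R) f0) (i : Fin M) :
    Tendsto (fun c : ℕ × ℕ => pmOmega G R e0 f0 c.1 c.2 i) atTop (𝓝 (omegaStar R)) := by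
  have hspec := spectrum_eq_range_of_eigenbasis v lam hv
  have hfin : (spectrum ℝ R).Finite := hspec ▸ Set.finite_range lam
  have hmax : ∀ k, lam k ≤ eigMax R := fun k =>
    le_csSup hfin.bddAbove (hspec ▸ Set.mem_range_self k)
  have hmin : ∀ k, eigMin R ≤ lam k := fun k =>
    csInf_le hfin.bddBelow (hspec ▸ Set.mem_range_self k)
  obtain ⟨k1, hk1, he1⟩ := he.exists_repr_ne_zero v hv
  obtain ⟨k2, hk2, hf2⟩ := hf.exists_repr_ne_zero v hv
  have hc1 : Tendsto (fun c : ℕ × ℕ => c.1) atTop atTop := by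
    rw [← prod_atTop_atTop_eq]; exact tendsto_fst
  have hc2 : Tendsto (fun c : ℕ × ℕ => c.2) atTop atTop := by
    rw [← prod_atTop_atTop_eq]; exact tendsto_snd
  have h1 : Tendsto (fun c : ℕ × ℕ => pmEig G R e0 c.1 i) atTop (𝓝 (eigMax R)) := by
    have := tendsto_pmEig (l := atTop) hG v (A := fun _ : ℕ × ℕ => R) (ev := fun _ => lam)
      (ev0 := lam) (fun _ => hv) (fun k => tendsto_const_nhds) he1 (hlam k1).ne' (fun k => by
        rw [abs_of_pos (hlam k), abs_of_pos (hlam k1)]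
        rcases (hmax k).lt_or_eq with h | h
        · right; rwa [hk1]
        · left; intro; rw [h, hk1]) hc1 i
    rwa [abs_of_pos (hlam k1), hk1] at this
  -- Each agent shifts its row by its own estimate; these agree, so the shift is scalar and keeps
  -- the eigenbasis.
  have hdiag : ∀ c : ℕ, Matrix.diagonal (pmEig G R e0 c) =
      pmEig G R e0 c i • (1 : Matrix (Fin M) (Fin M) ℝ) := by
    intro c
    rw [Matrix.smul_one_eq_diagonal]
    congr 1
    funext j
    exact pmEig_eq_pmEig hG _ _ _ _ _
  have h2 : Tendsto (fun c : ℕ × ℕ =>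
      pmEig G (R - Matrix.diagonal (pmEig G R e0 c.1)) f0 c.2 i) atTop
      (𝓝 |eigMin R - eigMax R|) := by
    simp_rw [hdiag]
    have hv' : ∀ (c : ℕ × ℕ) k, (R - pmEig G R e0 c.1 i • (1 : Matrix (Fin M) (Fin M) ℝ)) *ᵥ v k =
        (lam k - pmEig G R e0 c.1 i) • v k := by
      intro c k
      rw [Matrix.sub_mulVec, hv, Matrix.smul_mulVec, Matrix.one_mulVec, sub_smul]
    have hle : eigMin R ≤ eigMax R := (hmin k1).trans (hmax k1)
    rcases hle.lt_or_eq with hlt | heq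
    -- In the limit, the shifted eigenvalues lie in `[λ_min - λ_max, 0]`, so the dominant one comes
    -- from `λ_min`.
    · have := tendsto_pmEig (l := atTop) hG v (ev0 := fun k => lam k - eigMax R) hv'
        (fun k => h1.const_sub _) hf2 (by rw [hk2]; linarith) (fun k => by
          rw [hk2, abs_of_nonpos (by linarith [hmax k]), abs_of_neg (by linarith)]
          rcases (hmin k).lt_or_eq with h | h
          · right; linarith
          · left; intro; rw [← h]) hc2 i
      rwa [hk2] at this
    · have hR : R = eigMax R • (1 : Matrix (Fin M) (Fin M) ℝ) := by
        apply Matrix.toLin'.injective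
        refine v.ext fun k => ?_
        rw [Matrix.toLin'_apply, Matrix.toLin'_apply, hv, Matrix.smul_mulVec, Matrix.one_mulVec,
          le_antisymm (hmax k) (heq ▸ hmin k)]
      rw [heq, sub_self, abs_zero]
      have h3 : Tendsto (fun c : ℕ × ℕ => |eigMax R - pmEig G R e0 c.1 i|) atTop (𝓝 0) := by
        have := (h1.const_sub (eigMax R)).abs
        rwa [sub_self, abs_zero] at this
      refine squeeze_zero' (Eventually.of_forall fun c => norm_nonneg _) ?_ h3
      filter_upwards [hc2.eventually_ge_atTop 1] with c hc
      obtain ⟨t, ht⟩ := Nat.exists_eq_add_of_le' hc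
      rw [ht]
      have : R - pmEig G R e0 c.1 i • (1 : Matrix (Fin M) (Fin M) ℝ) =
          (eigMax R - pmEig G R e0 c.1 i) • (1 : Matrix (Fin M) (Fin M) ℝ) := by
        rw [sub_smul]
        exact congrArg (· - _) hR
      rw [this]
      exact pmEig_smul_one_le hG _ _ _ _
  have hpos : 0 < eigMax R + eigMin R := by
    have := hlam k1; have := hlam k2; rw [hk1] at *; rw [hk2] at *; linarith
  have h3 := h1.add ((h2.sub h1).abs)
  -- The inner modulus is `λ_max - λ_min`; subtracting `λ_max` leaves `-λ_min`, negative because the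
  -- spectrum is positive.
  have h4 : eigMax R + |(|eigMin R - eigMax R| - eigMax R)| = eigMax R + eigMin R := by
    have h5 : eigMin R ≤ eigMax R := (hmin k1).trans (hmax k1)
    have h6 := hlam k2
    rw [hk2] at h6
    rw [abs_of_nonpos (a := eigMin R - eigMax R) (by linarith), abs_of_nonpos (by linarith)]
    ring
  rw [h4] at h3
  exact tendsto_const_nhds.div h3 hpos.ne'

theorem pmOmega_eq_pmOmega (hG : StronglyComplete G) (R : Matrix (Fin M) (Fin M) ℝ)
    (e0 f0 : Fin M → ℝ) (s₁ s₂ : ℕ) (i j : Fin M) :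
    pmOmega G R e0 f0 s₁ s₂ i = pmOmega G R e0 f0 s₁ s₂ j := by
  rw [pmOmega, pmOmega, pmEig_eq_pmEig hG R e0 s₁ i j, pmEig_eq_pmEig hG _ f0 s₂ i j]

/-- The optimal relaxation factor lies in the range of convergence of JOR. -/
theorem omegaStar_mul_pos_and_lt_two {R : Matrix (Fin M) (Fin M) ℝ}
    (v : Module.Basis (Fin M) ℝ (Fin M → ℝ)) {lam : Fin M → ℝ}
    (hv : ∀ k, R *ᵥ v k = lam k • v k) (hlam : ∀ k, 0 < lam k) (k : Fin M) :
    0 < omegaStar R * lam k ∧ omegaStar R * lam k < 2 := by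
  have hspec := spectrum_eq_range_of_eigenbasis v lam hv
  have hfin : (spectrum ℝ R).Finite := hspec ▸ Set.finite_range lam
  have hmax : lam k ≤ eigMax R := le_csSup hfin.bddAbove (hspec ▸ Set.mem_range_self k)
  have hmin : 0 < eigMin R := by
    have hne : (spectrum ℝ R).Nonempty := hspec ▸ ⟨lam k, Set.mem_range_self k⟩
    have := hne.csInf_mem hfin
    rw [hspec] at this
    obtain ⟨j, hj⟩ := this
    rw [eigMin, hspec, ← hj]
    exact hlam j
  have hk := hlam k
  have hs : 0 < eigMax R + eigMin R := by linarith
  refine ⟨by unfold omegaStar; positivity, ?_⟩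
  rw [omegaStar, div_mul_eq_mul_div, div_lt_iff₀ hs]
  linarith

end Power

/-! ### Average consensus on time-varying graphs -/

section Consensus

variable {M : ℕ} {G : ℕ → SimpleGraph (Fin M)} {ε : ℝ}

open Classical in
/-- The difference `w j - w i` over the edge `ij`, and zero if there is no such edge. -/
noncomputable def edgeDiff (G : SimpleGraph (Fin M)) (w : Fin M → ℝ) (i j : Fin M) : ℝ :=
  if G.Adj i j then w j - w i else 0

theorem edgeDiff_comm (G : SimpleGraph (Fin M)) (w : Fin M → ℝ) (i j : Fin M) :
    edgeDiff G w j i = -edgeDiff G w i j := by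
  unfold edgeDiff
  by_cases h : G.Adj i j
  · rw [if_pos h, if_pos h.symm]; ring
  · rw [if_neg h, if_neg fun h' => h h'.symm]; ring

theorem dac_succ_apply (w : Fin M → ℝ) (t : ℕ) (i : Fin M) :
    dac G ε w (t + 1) i = dac G ε w t i + ε * ∑ j, edgeDiff (G t) (dac G ε w t) i j := rfl

open Classical in
theorem card_neighbors_le (G : ℕ → SimpleGraph (Fin M)) (t : ℕ) (i : Fin M) :
    (Finset.univ.filter fun j => (G t).Adj i j).card ≤ maxNeighbors G := by
  -- An unbounded supremum in `ℕ` would take the default value 0; degrees are bounded by `M`, so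
  -- this one is genuine.
  have hbdd : BddAbove (Set.range fun t => (G t).maxDegree) := by
    refine ⟨M, ?_⟩
    rintro _ ⟨t, rfl⟩
    refine SimpleGraph.maxDegree_le_of_forall_degree_le _ _ fun v => ?_
    exact (Finset.card_le_univ _).trans_eq (Fintype.card_fin M)
  refine le_trans ?_ (le_ciSup hbdd t)
  rw [← SimpleGraph.neighborFinset_eq_filter]
  exact (G t).degree_le_maxDegree i

theorem dac_sub (w w' : Fin M → ℝ) (t : ℕ) :
    dac G ε (w - w') t = dac G ε w t - dac G ε w' t := by
  induction t with
  | zero => rfl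
  | succ t ih =>
    ext i
    simp only [Pi.sub_apply, dac_succ_apply, ih]
    have : ∀ j, edgeDiff (G t) (dac G ε w t - dac G ε w' t) i j =
        edgeDiff (G t) (dac G ε w t) i j - edgeDiff (G t) (dac G ε w' t) i j := by
      intro j
      unfold edgeDiff
      split_ifs
      · simp only [Pi.sub_apply]; ring
      · ring
    simp only [this, Finset.sum_sub_distrib]
    ring

/-- The summand is antisymmetric in `i` and `j`. This is why consensus preserves the sum of the
states. -/
theorem sum_sum_edgeDiff (G : SimpleGraph (Fin M)) (w : Fin M → ℝ) :
    ∑ i, ∑ j, edgeDiff G w i j = 0 := by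
  have h : ∑ i, ∑ j, edgeDiff G w i j = -∑ i, ∑ j, edgeDiff G w i j := by
    conv_lhs => rw [Finset.sum_comm]
    simp_rw [← Finset.sum_neg_distrib]
    exact Finset.sum_congr rfl fun i _ => Finset.sum_congr rfl fun j _ => edgeDiff_comm G w i j
  linarith

theorem sum_dac (w : Fin M → ℝ) (t : ℕ) : ∑ i, dac G ε w t i = ∑ i, w i := by
  induction t with
  | zero => rfl
  | succ t ih =>
    simp only [dac_succ_apply, Finset.sum_add_distrib, ← Finset.mul_sum, sum_sum_edgeDiff, ih]
    ring

/-- A consensus round replaces the state of each agent by a convex combination of states. -/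
theorem dac_succ_mem_Icc (hε : 0 < ε) (hεΔ : ε * maxNeighbors G < 1) (w : Fin M → ℝ) {a b : ℝ}
    (t : ℕ) (h : ∀ i, dac G ε w t i ∈ Set.Icc a b) (i : Fin M) :
    dac G ε w (t + 1) i ∈ Set.Icc a b := by
  classical
  set z := dac G ε w t with hz
  set d : ℝ := ((Finset.univ.filter fun j => (G t).Adj i j).card : ℝ) with hd
  have hd1 : ε * d ≤ 1 := by
    refine le_trans ?_ hεΔ.le
    exact mul_le_mul_of_nonneg_left ((Nat.cast_le (α := ℝ)).2 (card_neighbors_le G t i)) hε.le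
  have hdn : 0 ≤ ε * d := by positivity
  have hsum : ∑ j, edgeDiff (G t) z i j =
      ∑ j ∈ Finset.univ.filter fun j => (G t).Adj i j, (z j - z i) := by
    rw [Finset.sum_filter]
    exact Finset.sum_congr rfl fun j _ => by unfold edgeDiff; congr
  have hub : ∑ j, edgeDiff (G t) z i j ≤ d * (b - z i) := by
    rw [hsum, hd, ← nsmul_eq_mul]
    exact Finset.sum_le_card_nsmul _ _ _ fun j _ => by linarith [(h j).2]
  have hlb : d * (a - z i) ≤ ∑ j, edgeDiff (G t) z i j := by
    rw [hsum, hd, ← nsmul_eq_mul]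
    exact Finset.card_nsmul_le_sum _ _ _ fun j _ => by linarith [(h j).1]
  rw [dac_succ_apply, ← hz]
  have hi := h i
  constructor
  · have := mul_le_mul_of_nonneg_left hlb hε.le
    nlinarith [hi.1]
  · have := mul_le_mul_of_nonneg_left hub hε.le
    nlinarith [hi.2]

theorem dac_add_mem_Icc (hε : 0 < ε) (hεΔ : ε * maxNeighbors G < 1) (w : Fin M → ℝ) {a b : ℝ}
    (t : ℕ) (h : ∀ i, dac G ε w t i ∈ Set.Icc a b) (k : ℕ) (i : Fin M) :
    dac G ε w (t + k) i ∈ Set.Icc a b := by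
  induction k generalizing i with
  | zero => exact h i
  | succ k ih => exact dac_succ_mem_Icc hε hεΔ w (t + k) ih i

theorem norm_dac_le (hε : 0 < ε) (hεΔ : ε * maxNeighbors G < 1) (w : Fin M → ℝ) (t : ℕ) :
    ‖dac G ε w t‖ ≤ ‖w‖ := by
  refine (pi_norm_le_iff_of_nonneg (norm_nonneg _)).2 fun i => ?_
  have := dac_add_mem_Icc hε hεΔ w (a := -‖w‖) (b := ‖w‖) 0
    (fun i => abs_le.1 (norm_le_pi_norm w i)) t i
  rw [zero_add] at this
  exact abs_le.2 this

/-- A consensus round decreases the sum of squares by a multiple of the disagreement. -/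
theorem sum_sq_dac_succ_le (w : Fin M → ℝ) (t : ℕ) :
    ∑ i, dac G ε w (t + 1) i ^ 2 ≤ ∑ i, dac G ε w t i ^ 2 -
      ε * (1 - ε * maxNeighbors G) * ∑ i, ∑ j, edgeDiff (G t) (dac G ε w t) i j ^ 2 := by
  classical
  set z := dac G ε w t with hz
  set Δ : ℝ := (maxNeighbors G : ℝ)
  set Q := ∑ i, ∑ j, edgeDiff (G t) z i j ^ 2 with hQ
  -- Symmetrizing over the two orientations of each edge turns the cross term into minus the
  -- disagreement.
  have hcross : 2 * ∑ i, z i * ∑ j, edgeDiff (G t) z i j = -Q := by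
    have h1 : ∑ i, z i * ∑ j, edgeDiff (G t) z i j = ∑ i, ∑ j, z i * edgeDiff (G t) z i j := by
      simp_rw [Finset.mul_sum]
    have h2 : ∑ i, z i * ∑ j, edgeDiff (G t) z i j = ∑ i, ∑ j, -(z j * edgeDiff (G t) z i j) := by
      rw [h1, Finset.sum_comm]
      refine Finset.sum_congr rfl fun i _ => Finset.sum_congr rfl fun j _ => ?_
      rw [edgeDiff_comm (G t) z i j]; ring
    rw [two_mul]
    nth_rewrite 1 [h1]
    rw [h2, hQ, ← Finset.sum_add_distrib, ← Finset.sum_neg_distrib]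
    refine Finset.sum_congr rfl fun i _ => ?_
    rw [← Finset.sum_add_distrib, ← Finset.sum_neg_distrib]
    refine Finset.sum_congr rfl fun j _ => ?_
    unfold edgeDiff
    split_ifs <;> ring
  -- Cauchy–Schwarz over at most `Δ` neighbors.
  have hsq : ∑ i, (∑ j, edgeDiff (G t) z i j) ^ 2 ≤ Δ * Q := by
    rw [hQ, Finset.mul_sum]
    refine Finset.sum_le_sum fun i _ => ?_
    have e1 : ∑ j, edgeDiff (G t) z i j =
        ∑ j ∈ Finset.univ.filter (fun j => (G t).Adj i j), edgeDiff (G t) z i j := by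
      rw [Finset.sum_filter]
      refine Finset.sum_congr rfl fun j _ => ?_
      unfold edgeDiff
      split_ifs <;> rfl
    rw [e1]
    refine (sq_sum_le_card_mul_sum_sq).trans ?_
    refine mul_le_mul ((Nat.cast_le (α := ℝ)).2 (card_neighbors_le G t i)) ?_
      (Finset.sum_nonneg fun _ _ => sq_nonneg _) (Nat.cast_nonneg _)
    exact Finset.sum_le_sum_of_subset_of_nonneg (Finset.filter_subset _ _)
      fun _ _ _ => sq_nonneg _
  have hexp : ∑ i, dac G ε w (t + 1) i ^ 2 = ∑ i, z i ^ 2 +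
      ε * (2 * ∑ i, z i * ∑ j, edgeDiff (G t) z i j) +
      ε ^ 2 * ∑ i, (∑ j, edgeDiff (G t) z i j) ^ 2 := by
    simp only [dac_succ_apply, ← hz, Finset.mul_sum (ι := Fin M) (s := Finset.univ)
      (f := fun i => z i * ∑ j, edgeDiff (G t) z i j),
      Finset.mul_sum (ι := Fin M) (s := Finset.univ)
      (f := fun i => (∑ j, edgeDiff (G t) z i j) ^ 2),
      Finset.mul_sum (ι := Fin M) (s := Finset.univ)
      (f := fun i => 2 * (z i * ∑ j, edgeDiff (G t) z i j)), ← Finset.sum_add_distrib]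
    exact Finset.sum_congr rfl fun i _ => by ring
  rw [hexp, hcross]
  have := mul_le_mul_of_nonneg_left hsq (sq_nonneg ε)
  nlinarith

/-- The sum of squares is nonincreasing and bounded below, so its decrements tend to zero, and each
decrement dominates a fixed positive multiple of the squared edge difference. -/
theorem tendsto_edgeDiff_dac (hε : 0 < ε) (hεΔ : ε * maxNeighbors G < 1) (w : Fin M → ℝ)
    (i j : Fin M) : Tendsto (fun t => edgeDiff (G t) (dac G ε w t) i j) atTop (𝓝 0) := by
  set V : ℕ → ℝ := fun t => ∑ i, dac G ε w t i ^ 2 with hV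
  set δ := ε * (1 - ε * maxNeighbors G) with hδ
  have hδ0 : 0 < δ := mul_pos hε (by linarith)
  have hstep : ∀ t, δ * edgeDiff (G t) (dac G ε w t) i j ^ 2 ≤ V t - V (t + 1) := by
    intro t
    have h1 := sum_sq_dac_succ_le (G := G) (ε := ε) w t
    have h2 : edgeDiff (G t) (dac G ε w t) i j ^ 2 ≤
        ∑ i, ∑ j, edgeDiff (G t) (dac G ε w t) i j ^ 2 :=
      (Finset.single_le_sum (f := fun j => edgeDiff (G t) (dac G ε w t) i j ^ 2)
        (fun _ _ => sq_nonneg _) (Finset.mem_univ j)).trans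
      (Finset.single_le_sum (f := fun i => ∑ j, edgeDiff (G t) (dac G ε w t) i j ^ 2)
        (fun _ _ => Finset.sum_nonneg fun _ _ => sq_nonneg _) (Finset.mem_univ i))
    have := mul_le_mul_of_nonneg_left h2 hδ0.le
    linarith
  have hanti : Antitone V := antitone_nat_of_succ_le fun t => by
    have := hstep t
    have : 0 ≤ δ * edgeDiff (G t) (dac G ε w t) i j ^ 2 := by positivity
    linarith
  have hlim := tendsto_atTop_ciInf hanti
    ⟨0, by rintro _ ⟨t, rfl⟩; exact Finset.sum_nonneg fun _ _ => sq_nonneg _⟩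
  have hdiff : Tendsto (fun t => V t - V (t + 1)) atTop (𝓝 0) := by
    simpa using hlim.sub (hlim.comp (tendsto_add_atTop_nat 1))
  have hsq : Tendsto (fun t => edgeDiff (G t) (dac G ε w t) i j ^ 2) atTop (𝓝 0) := by
    refine squeeze_zero (fun _ => sq_nonneg _) (g := fun t => δ⁻¹ * (V t - V (t + 1)))
      (fun t => ?_) (by simpa using hdiff.const_mul δ⁻¹)
    rw [inv_mul_eq_div, le_div_iff₀ hδ0, mul_comm]
    exact hstep t
  refine (tendsto_zero_iff_abs_tendsto_zero _).2 ?_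
  have := hsq.sqrt
  simpa [Function.comp_def, Real.sqrt_sq_eq_abs] using this

/-- States move ever less over a bounded number of rounds, so edges present at different times of a
window can all be compared at its start. -/
theorem tendsto_dac_add_sub (hε : 0 < ε) (hεΔ : ε * maxNeighbors G < 1) (w : Fin M → ℝ)
    (k : ℕ) (i : Fin M) :
    Tendsto (fun t => dac G ε w (t + k) i - dac G ε w t i) atTop (𝓝 0) := by
  induction k with
  | zero => simp
  | succ k ih =>
    have h : Tendsto (fun t => ε * ∑ j, edgeDiff (G t) (dac G ε w t) i j) atTop (𝓝 0) := by
      have := (tendsto_finsetSum Finset.univ fun j _ =>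
        tendsto_edgeDiff_dac hε hεΔ w i j).const_mul ε
      simpa using this
    have := ih.add (h.comp (tendsto_add_atTop_nat k))
    rw [add_zero] at this
    refine this.congr fun t => ?_
    simp only [Function.comp_apply, ← add_assoc, dac_succ_apply]
    ring

theorem abs_sub_le_of_walk {V : Type*} {H : SimpleGraph V} {z : V → ℝ} {η : ℝ}
    (h : ∀ i j, H.Adj i j → |z i - z j| ≤ η) {i j : V} (p : H.Walk i j) :
    |z i - z j| ≤ p.length * η := by
  induction p with
  | nil => simp
  | cons hadj p ih =>
    rename_i u v x
    rw [SimpleGraph.Walk.length_cons, Nat.cast_succ]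
    have := abs_sub_le (z u) (z v) (z x)
    linarith [h _ _ hadj]

/-- Under repeated connectivity, average consensus converges to the average. -/
theorem tendsto_dac (hG : RepeatedlyConnected G) (hε : 0 < ε) (hεΔ : ε * maxNeighbors G < 1)
    (w : Fin M → ℝ) (i : Fin M) :
    Tendsto (fun t => dac G ε w t i) atTop (𝓝 ((∑ j, w j) / M)) := by
  obtain ⟨γ, hγ, hconn⟩ := hG
  have hM : (0 : ℝ) < M := by exact_mod_cast i.pos
  rw [Metric.tendsto_atTop]
  intro r hr
  -- A path has fewer than `M` edges, so an edge tolerance `η` gives a spread of at most `M * η <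
  -- r`.
  set η := r / (2 * M + 1) with hη
  have hη0 : 0 < η := by positivity
  have hmul : ∀ k, Tendsto (fun t : ℕ => t * γ + k) atTop atTop := fun k =>
    (tendsto_add_atTop_nat k).comp (tendsto_id.atTop_mul_const' hγ)
  have hmul' : Tendsto (fun t : ℕ => t * γ) atTop atTop := hmul 0
  have hedge : ∀ i j, ∀ k : Fin γ, ∀ᶠ t : ℕ in atTop, (G (t * γ + k)).Adj i j →
      |dac G ε w (t * γ) i - dac G ε w (t * γ) j| ≤ η := by
    intro i j k
    have h1 := (tendsto_edgeDiff_dac hε hεΔ w i j).comp (hmul k)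
    have h2 := (tendsto_dac_add_sub hε hεΔ w k i).comp hmul'
    have h3 := (tendsto_dac_add_sub hε hεΔ w k j).comp hmul'
    have h4 : Tendsto (fun t : ℕ => |edgeDiff (G (t * γ + k)) (dac G ε w (t * γ + k)) i j| +
        |dac G ε w (t * γ + k) i - dac G ε w (t * γ) i| +
        |dac G ε w (t * γ + k) j - dac G ε w (t * γ) j|) atTop (𝓝 0) := by
      simpa using (h1.abs.add h2.abs).add h3.abs
    filter_upwards [h4.eventually_lt_const hη0] with t ht hadj
    rw [edgeDiff, if_pos hadj] at ht
    rw [abs_le]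
    constructor <;>
    linarith [le_abs_self (dac G ε w (t * γ + k) j - dac G ε w (t * γ + k) i),
      neg_abs_le (dac G ε w (t * γ + k) j - dac G ε w (t * γ + k) i),
      le_abs_self (dac G ε w (t * γ + k) i - dac G ε w (t * γ) i),
      neg_abs_le (dac G ε w (t * γ + k) i - dac G ε w (t * γ) i),
      le_abs_self (dac G ε w (t * γ + k) j - dac G ε w (t * γ) j),
      neg_abs_le (dac G ε w (t * γ + k) j - dac G ε w (t * γ) j)]
  have hall : ∀ᶠ t : ℕ in atTop, ∀ i j, ∀ k : Fin γ, (G (t * γ + k)).Adj i j →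
      |dac G ε w (t * γ) i - dac G ε w (t * γ) j| ≤ η :=
    eventually_all.2 fun i => eventually_all.2 fun j => eventually_all.2 fun k => hedge i j k
  -- One good window suffices: the interval that it yields around the mean is invariant under all
  -- later rounds.
  obtain ⟨t, ht⟩ := hall.exists
  have hpair : ∀ i j, |dac G ε w (t * γ) i - dac G ε w (t * γ) j| ≤ M * η := by
    intro i j
    obtain ⟨p, hp⟩ := ((hconn t).preconnected i j).exists_isPath
    have h1 := abs_sub_le_of_walk (z := dac G ε w (t * γ)) (η := η) (fun i j hij => by
      obtain ⟨k, hk⟩ := SimpleGraph.iSup_adj.1 hij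
      exact ht i j k hk) p
    have h2 : (p.length : ℝ) ≤ M := by
      have := hp.length_lt
      rw [Fintype.card_fin] at this
      exact_mod_cast this.le
    exact h1.trans (by gcongr)
  set m := (∑ j, w j) / M with hm
  have hmem : ∀ i, dac G ε w (t * γ) i ∈ Set.Icc (m - M * η) (m + M * η) := by
    intro i
    have hsum : m * M = ∑ j, dac G ε w (t * γ) j := by
      rw [sum_dac, hm, div_mul_cancel₀ _ hM.ne']
    have hub : ∑ j, dac G ε w (t * γ) j ≤ ∑ _j : Fin M, (dac G ε w (t * γ) i + M * η) :=
      Finset.sum_le_sum fun j _ => by linarith [(abs_le.1 (hpair i j)).1]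
    have hlb : ∑ _j : Fin M, (dac G ε w (t * γ) i - M * η) ≤ ∑ j, dac G ε w (t * γ) j :=
      Finset.sum_le_sum fun j _ => by linarith [(abs_le.1 (hpair i j)).2]
    rw [Finset.sum_const, Finset.card_univ, Fintype.card_fin, nsmul_eq_mul, ← hsum,
      mul_comm m] at hub hlb
    have hub' := le_of_mul_le_mul_left hub hM
    have hlb' := le_of_mul_le_mul_left hlb hM
    constructor <;> linarith
  refine ⟨t * γ, fun s hs => ?_⟩
  obtain ⟨k, rfl⟩ := Nat.exists_eq_add_of_le hs
  have := dac_add_mem_Icc hε hεΔ w (t * γ) hmem k i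
  rw [Real.dist_eq]
  have hlt : M * η < r := by
    rw [hη, ← mul_div_assoc, div_lt_iff₀ (by positivity)]
    nlinarith
  rw [abs_lt]
  constructor <;> linarith [this.1, this.2]

/-- Consensus from convergent initial values, when all iteration counts tend to infinity. -/
theorem tendsto_dac_of_tendsto (hG : RepeatedlyConnected G) (hε : 0 < ε)
    (hεΔ : ε * maxNeighbors G < 1) {κ : Type*} {l : Filter κ} {w : κ → Fin M → ℝ}
    {w0 : Fin M → ℝ} (hw : Tendsto w l (𝓝 w0)) {t : κ → ℕ} (ht : Tendsto t l atTop)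
    (i : Fin M) : Tendsto (fun c => dac G ε (w c) (t c) i) l (𝓝 ((∑ j, w0 j) / M)) := by
  -- By linearity the perturbation evolves separately, and nonexpansiveness in the sup norm bounds
  -- it uniformly in the number of rounds.
  have h1 : Tendsto (fun c => dac G ε (w c - w0) (t c) i) l (𝓝 0) := by
    have h0 : Tendsto (fun c => ‖w c - w0‖) l (𝓝 0) := tendsto_iff_norm_sub_tendsto_zero.1 hw
    exact squeeze_zero_norm (fun c => (norm_le_pi_norm _ i).trans (norm_dac_le hε hεΔ _ _)) h0
  have h2 := (tendsto_dac hG hε hεΔ w0 i).comp ht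
  have := h1.add h2
  rw [zero_add] at this
  refine this.congr fun c => ?_
  simp [dac_sub]

end Consensus

/-! ### Best linear prediction -/

section Quadratic

theorem transpose_eq_of_posDef {ι : Type*} {C : Matrix ι ι ℝ} (hC : C.PosDef) : Cᵀ = C := by
  simpa [Matrix.IsSymm] using hC.1

variable {ι : Type*} [Fintype ι]

theorem dotProduct_mulVec_comm_of_isSymm {C : Matrix ι ι ℝ} (hC : Cᵀ = C) (a b : ι → ℝ) :
    a ⬝ᵥ (C *ᵥ b) = b ⬝ᵥ (C *ᵥ a) := by
  rw [Matrix.dotProduct_mulVec, ← Matrix.mulVec_transpose, hC, dotProduct_comm]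

variable [DecidableEq ι]

theorem mulVec_inv_mulVec_of_posDef {C : Matrix ι ι ℝ} (hC : C.PosDef) (k : ι → ℝ) :
    C *ᵥ (C⁻¹ *ᵥ k) = k := by
  rw [Matrix.mulVec_mulVec, Matrix.mul_nonsing_inv _ ((Matrix.isUnit_iff_isUnit_det _).1 hC.isUnit),
    Matrix.one_mulVec]

/-- Completing the square: the error of a linear predictor `c` relative to the best one. -/
theorem quadratic_sub_inv_mulVec {C : Matrix ι ι ℝ} (hC : C.PosDef) (c k : ι → ℝ) :
    (c - C⁻¹ *ᵥ k) ⬝ᵥ (C *ᵥ (c - C⁻¹ *ᵥ k)) =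
      c ⬝ᵥ (C *ᵥ c) - 2 * (c ⬝ᵥ k) + k ⬝ᵥ (C⁻¹ *ᵥ k) := by
  have h1 : (C⁻¹ *ᵥ k) ⬝ᵥ (C *ᵥ c) = c ⬝ᵥ k := by
    rw [dotProduct_mulVec_comm_of_isSymm (transpose_eq_of_posDef hC),
      mulVec_inv_mulVec_of_posDef hC]
  rw [Matrix.mulVec_sub, mulVec_inv_mulVec_of_posDef hC, sub_dotProduct, dotProduct_sub,
    dotProduct_sub, h1, dotProduct_comm (C⁻¹ *ᵥ k) k]
  ring

/-- The completed square is nonnegative. Every test vector `c` thus gives an upper bound on a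
posterior variance. -/
theorem two_mul_dotProduct_sub_le {C : Matrix ι ι ℝ} (hC : C.PosDef) (c k : ι → ℝ) :
    2 * (c ⬝ᵥ k) - c ⬝ᵥ (C *ᵥ c) ≤ k ⬝ᵥ (C⁻¹ *ᵥ k) := by
  have h := quadratic_sub_inv_mulVec hC c k
  have h0 : 0 ≤ (c - C⁻¹ *ᵥ k) ⬝ᵥ (C *ᵥ (c - C⁻¹ *ᵥ k)) := by
    simpa using hC.posSemidef.dotProduct_mulVec_nonneg (c - C⁻¹ *ᵥ k)
  linarith

end Quadratic

/-! ### Kernel positivity and the posterior variance -/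

section Kernel

variable {D : ℕ} {Ω : Type*} [MeasurableSpace Ω]

theorem seKernel_comm (θ : Hyper D) (x x' : Loc D) : seKernel θ x x' = seKernel θ x' x := by
  unfold seKernel
  congr 3
  exact Finset.sum_congr rfl fun d _ => by ring

theorem seKernel_self (θ : Hyper D) (x : Loc D) : seKernel θ x x = θ.sigF ^ 2 := by
  simp [seKernel]

theorem seKernel_pos (θ : Hyper D) (x x' : Loc D) : 0 < seKernel θ x x' :=
  mul_pos (pow_pos θ.sigF_pos 2) (Real.exp_pos _)

theorem seKernel_le (θ : Hyper D) (x x' : Loc D) : seKernel θ x x' ≤ θ.sigF ^ 2 := by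
  refine mul_le_of_le_one_right (sq_nonneg _) (Real.exp_le_one_iff.2 ?_)
  exact neg_nonpos.2 (Finset.sum_nonneg fun d _ => by positivity)

theorem continuous_seKernel_left (θ : Hyper D) (x : Loc D) :
    Continuous fun x' => seKernel θ x' x := by
  unfold seKernel
  fun_prop

/-- The kernel is positive semidefinite on every finite family of locations. -/
def KernelPosSemidef (θ : Hyper D) : Prop :=
  ∀ (ι : Type) [Fintype ι] (X : ι → Loc D) (c : ι → ℝ),
    0 ≤ ∑ p, ∑ q, c p * c q * seKernel θ (X p) (X q)

/-- The double sum is the variance of `∑ c_p f(X_p)`, so the existence of the process gives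
positivity. -/
theorem kernelPosSemidef_of_cov {P : Measure Ω} [IsProbabilityMeasure P] {θ : Hyper D}
    {f : Loc D → Ω → ℝ} (hf : ∀ x, MemLp (f x) 2 P)
    (hcov : ∀ x x', cov[f x, f x'; P] = seKernel θ x x') : KernelPosSemidef θ := by
  intro ι _ X c
  have hmem : ∀ p, MemLp (fun w => c p * f (X p) w) 2 P := fun p => (hf _).const_mul _
  have h := covariance_fun_sum_fun_sum (μ := P) hmem hmem
  have haem : AEMeasurable (fun w => ∑ p, c p * f (X p) w) P :=
    (memLp_finsetSum _ fun p _ => hmem p).aemeasurable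
  rw [covariance_self haem] at h
  have h0 := variance_nonneg (fun w => ∑ p, c p * f (X p) w) P
  rw [h] at h0
  simp only [covariance_const_mul_left, covariance_const_mul_right, hcov] at h0
  exact h0.trans_eq (Finset.sum_congr rfl fun p _ => Finset.sum_congr rfl fun q _ => by ring)

variable {ι : Type} [Fintype ι] [DecidableEq ι]

theorem dotProduct_covMat_mulVec (θ : Hyper D) (X : ι → Loc D) (c : ι → ℝ) :
    c ⬝ᵥ (covMat θ X *ᵥ c) =
      ∑ p, ∑ q, c p * c q * seKernel θ (X p) (X q) + θ.sigE ^ 2 * (c ⬝ᵥ c) := by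
  rw [covMat, Matrix.add_mulVec, dotProduct_add, Matrix.smul_mulVec, Matrix.one_mulVec,
    dotProduct_smul, smul_eq_mul]
  congr 1
  simp only [dotProduct, Matrix.mulVec, Matrix.of_apply, Finset.mul_sum]
  exact Finset.sum_congr rfl fun p _ => Finset.sum_congr rfl fun q _ => by ring

theorem covMat_posDef {θ : Hyper D} (hθ : KernelPosSemidef θ) (X : ι → Loc D) :
    (covMat θ X).PosDef := by
  refine Matrix.PosDef.of_dotProduct_mulVec_pos ?_ fun c hc => ?_
  · ext a b
    simp [covMat, seKernel_comm θ (X a) (X b), Matrix.one_apply, eq_comm]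
  · rw [star_trivial, dotProduct_covMat_mulVec]
    have h1 : 0 < c ⬝ᵥ c := by
      have := Matrix.dotProduct_star_self_pos_iff.2 hc
      simpa using this
    have := mul_pos (pow_pos θ.sigE_pos 2) h1
    linarith [hθ ι X c]

theorem postVar_nonneg {θ : Hyper D} (hθ : KernelPosSemidef θ) (X : ι → Loc D) (x : Loc D) :
    0 ≤ postVar θ X x := by
  set a := (covMat θ X)⁻¹ *ᵥ kVec θ X x with ha
  have hC := covMat_posDef hθ X
  -- The prediction location joins the inputs, with coefficient 1 against `-a`: the form is the mean
  -- square error of predicting `f x` by the weights `a` from noiseless values.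
  have h := hθ (Option ι) (fun o => o.elim x X) (fun o => o.elim 1 fun p => -a p)
  simp only [Fintype.sum_option, Option.elim_none, Option.elim_some, one_mul, mul_one] at h
  have h1 : a ⬝ᵥ (covMat θ X *ᵥ a) = a ⬝ᵥ kVec θ X x := by
    rw [ha, mulVec_inv_mulVec_of_posDef hC]
  rw [dotProduct_covMat_mulVec] at h1
  have h2 : 0 ≤ θ.sigE ^ 2 * (a ⬝ᵥ a) := by
    have : 0 ≤ a ⬝ᵥ a := Finset.sum_nonneg fun _ _ => mul_self_nonneg _
    positivity
  have h3 : ∑ p, -a p * seKernel θ x (X p) = -(a ⬝ᵥ kVec θ X x) := by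
    simp only [dotProduct, kVec, neg_mul, Finset.sum_neg_distrib, seKernel_comm θ x]
  have h4 : ∑ p, (-a p * seKernel θ (X p) x + ∑ q, -a p * -a q * seKernel θ (X p) (X q)) =
      -(a ⬝ᵥ kVec θ X x) + ∑ p, ∑ q, a p * a q * seKernel θ (X p) (X q) := by
    simp only [Finset.sum_add_distrib, dotProduct, kVec, neg_mul, Finset.sum_neg_distrib,
      mul_neg, neg_neg]
  rw [h3, h4] at h
  rw [postVar, ← ha, dotProduct_comm]
  linarith

/-- The posterior variance is small if many inputs are close to the prediction location. -/
theorem postVar_le {θ : Hyper D} (hθ : KernelPosSemidef θ) (X : ι → Loc D) (x : Loc D) {η : ℝ}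
    (T : Finset ι) (hT : T.Nonempty) (hη : ∀ p ∈ T, θ.sigF ^ 2 - η ≤ seKernel θ (X p) x) :
    postVar θ X x ≤ 2 * η + θ.sigE ^ 2 / T.card := by
  have hm : (0 : ℝ) < T.card := by exact_mod_cast hT.card_pos
  set m : ℝ := (T.card : ℝ) with hmdef
  -- The test predictor averages the observations in `T`; averaging reduces the noise variance to
  -- `σ_ε² / m`.
  set c : ι → ℝ := fun p => if p ∈ T then m⁻¹ else 0 with hc
  have hC := covMat_posDef hθ X
  have h := two_mul_dotProduct_sub_le hC c (kVec θ X x)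
  have hsum : ∑ p, c p = 1 := by
    rw [hc, Finset.sum_ite_mem, Finset.univ_inter, Finset.sum_const, nsmul_eq_mul,
      mul_inv_cancel₀ hm.ne']
  have hc0 : ∀ p, 0 ≤ c p := fun p => by
    simp only [hc]; split_ifs <;> positivity
  have h1 : θ.sigF ^ 2 - η ≤ c ⬝ᵥ kVec θ X x := by
    calc θ.sigF ^ 2 - η = ∑ p, c p * (θ.sigF ^ 2 - η) := by
          rw [← Finset.sum_mul, hsum, one_mul]
      _ ≤ ∑ p, c p * seKernel θ (X p) x := by
          refine Finset.sum_le_sum fun p _ => ?_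
          by_cases hp : p ∈ T
          · exact mul_le_mul_of_nonneg_left (hη p hp) (hc0 p)
          · simp [hc, hp]
  have h2 : ∑ p, ∑ q, c p * c q * seKernel θ (X p) (X q) ≤ θ.sigF ^ 2 := by
    calc ∑ p, ∑ q, c p * c q * seKernel θ (X p) (X q)
        ≤ ∑ p, ∑ q, c p * c q * θ.sigF ^ 2 :=
          Finset.sum_le_sum fun p _ => Finset.sum_le_sum fun q _ =>
            mul_le_mul_of_nonneg_left (seKernel_le θ _ _) (mul_nonneg (hc0 p) (hc0 q))
      _ = θ.sigF ^ 2 := by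
          simp_rw [← Finset.sum_mul, ← Finset.mul_sum, hsum, mul_one, hsum, one_mul]
  have h3 : c ⬝ᵥ c = m⁻¹ := by
    simp only [dotProduct, hc, mul_ite, ite_mul, zero_mul, mul_zero]
    simp only [← ite_and, and_self]
    rw [Finset.sum_ite_mem, Finset.univ_inter, Finset.sum_const, nsmul_eq_mul, ← hmdef]
    field_simp
  rw [dotProduct_covMat_mulVec, h3] at h
  rw [postVar, seKernel_self, div_eq_mul_inv]
  linarith

end Kernel

/-! ### NPAE as a compression of the full GP -/

section Npae

variable {D M n : ℕ}

/-- Column `i` holds the weights of the prediction of agent `i` on all observations. -/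
noncomputable def expertWeights (θ : Hyper D) (X : Fin M → Fin n → Loc D) (x : Loc D) :
    Matrix (Fin M × Fin n) (Fin M) ℝ :=
  Matrix.of fun p i => if p.1 = i then ((covMat θ (X i))⁻¹ *ᵥ kVec θ (X i) x) p.2 else 0

/-- The NPAE aggregation of the local means. -/
noncomputable def npaeMean (θ : Hyper D) (X : Fin M → Fin n → Loc D) (y : Fin M → Fin n → ℝ)
    (x : Loc D) : ℝ :=
  crossVec θ X x ⬝ᵥ ((aggCov θ X x)⁻¹ *ᵥ localMean θ X y x)

/-- The NPAE prediction variance. -/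
noncomputable def npaeVar (θ : Hyper D) (X : Fin M → Fin n → Loc D) (x : Loc D) : ℝ :=
  seKernel θ x x - crossVec θ X x ⬝ᵥ ((aggCov θ X x)⁻¹ *ᵥ crossVec θ X x)

variable {θ : Hyper D} (X : Fin M → Fin n → Loc D) (x : Loc D)

theorem expertWeights_transpose_mulVec (z : Fin M × Fin n → ℝ) (i : Fin M) :
    ((expertWeights θ X x)ᵀ *ᵥ z) i =
      ((covMat θ (X i))⁻¹ *ᵥ kVec θ (X i) x) ⬝ᵥ fun a => z (i, a) := by
  simp only [Matrix.mulVec, dotProduct, expertWeights, Matrix.transpose_apply, Matrix.of_apply,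
    Fintype.sum_prod_type, ite_mul, zero_mul]
  rw [Finset.sum_eq_single i]
  · simp
  · intro j _ hj
    simp [hj]
  · simp

theorem covMat_prod_apply (p q : Fin M × Fin n) :
    covMat θ (fun p : Fin M × Fin n => X p.1 p.2) p q = pairCov θ X p.1 q.1 p.2 q.2 := by
  obtain ⟨i, a⟩ := p
  obtain ⟨j, b⟩ := q
  by_cases hij : i = j
  · simp [covMat, pairCov, hij, Matrix.one_apply]
  · simp [covMat, pairCov, hij]

theorem crossVec_eq :
    crossVec θ X x =
      (expertWeights θ X x)ᵀ *ᵥ kVec θ (fun p : Fin M × Fin n => X p.1 p.2) x := by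
  ext i
  rw [expertWeights_transpose_mulVec, crossVec, dotProduct_comm]
  rfl

theorem localMean_eq (hθ : KernelPosSemidef θ) (y : Fin M → Fin n → ℝ) :
    localMean θ X y x =
      (expertWeights θ X x)ᵀ *ᵥ fun p : Fin M × Fin n => y p.1 p.2 := by
  ext i
  rw [expertWeights_transpose_mulVec, localMean, postMean,
    dotProduct_mulVec_comm_of_isSymm (transpose_eq_of_posDef (covMat_posDef hθ (X i)).inv),
    dotProduct_comm]

/-- `C_A` is the covariance of the local means, which are the combinations `Wᵀ y` of the
observations. Zero blocks of `W` leave only the pair `(i, j)` in entry `(i, j)`. -/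
theorem aggCov_eq (hθ : KernelPosSemidef θ) :
    aggCov θ X x = (expertWeights θ X x)ᵀ *
      covMat θ (fun p : Fin M × Fin n => X p.1 p.2) * expertWeights θ X x := by
  ext i j
  have h1 : ((expertWeights θ X x)ᵀ * covMat θ (fun p : Fin M × Fin n => X p.1 p.2) *
      expertWeights θ X x) i j = ((expertWeights θ X x)ᵀ *ᵥ
        (covMat θ (fun p : Fin M × Fin n => X p.1 p.2) *ᵥ
          fun q => expertWeights θ X x q j)) i := by
    rw [Matrix.mulVec_mulVec]
    rfl
  rw [h1, expertWeights_transpose_mulVec, aggCov, Matrix.of_apply]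
  have h2 : (fun a => (covMat θ (fun p : Fin M × Fin n => X p.1 p.2) *ᵥ
      fun q => expertWeights θ X x q j) (i, a)) =
      pairCov θ X i j *ᵥ ((covMat θ (X j))⁻¹ *ᵥ kVec θ (X j) x) := by
    ext a
    simp only [Matrix.mulVec, dotProduct, covMat_prod_apply, Fintype.sum_prod_type]
    rw [Finset.sum_eq_single j]
    · simp [expertWeights, Matrix.mulVec, dotProduct]
    · intro l _ hl
      simp [expertWeights, hl]
    · simp
  rw [h2, ← Matrix.mulVec_mulVec, ← Matrix.mulVec_mulVec,
    dotProduct_mulVec_comm_of_isSymm (transpose_eq_of_posDef (covMat_posDef hθ (X i)).inv),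
    dotProduct_comm]

/-- Columns have disjoint supports, and none vanishes because the kernel is strictly positive and
every agent has an observation; for `n = 0` the columns would be empty. -/
theorem expertWeights_mulVec_injective (hθ : KernelPosSemidef θ) (hn : 1 ≤ n) :
    Function.Injective (expertWeights θ X x).mulVec := by
  intro u v huv
  ext i
  have hne : (covMat θ (X i))⁻¹ *ᵥ kVec θ (X i) x ≠ 0 := by
    intro h
    have h1 := mulVec_inv_mulVec_of_posDef (covMat_posDef hθ (X i)) (kVec θ (X i) x)
    rw [h, Matrix.mulVec_zero] at h1
    exact (seKernel_pos θ (X i ⟨0, hn⟩) x).ne (congrFun h1 ⟨0, hn⟩)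
  obtain ⟨a, ha⟩ := Function.ne_iff.1 hne
  have h := congrFun huv (i, a)
  simp only [Matrix.mulVec, dotProduct, expertWeights, Matrix.of_apply, ite_mul, zero_mul,
    Finset.sum_ite_eq, Finset.mem_univ, if_true] at h
  exact mul_left_cancel₀ ha h

theorem aggCov_posDef (hθ : KernelPosSemidef θ) (hn : 1 ≤ n) : (aggCov θ X x).PosDef := by
  rw [aggCov_eq X x hθ]
  have := (covMat_posDef hθ (fun p : Fin M × Fin n => X p.1 p.2)).conjTranspose_mul_mul_same
    (expertWeights_mulVec_injective X x hθ hn)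
  simpa using this

theorem aggCov_self (hθ : KernelPosSemidef θ) (i : Fin M) :
    aggCov θ X x i i = crossVec θ X x i := by
  have h : pairCov θ X i i = covMat θ (X i) := by simp [pairCov, covMat]
  have hu := (Matrix.isUnit_iff_isUnit_det _).1 (covMat_posDef hθ (X i)).isUnit
  rw [aggCov, Matrix.of_apply, h, Matrix.nonsing_inv_mul _ hu, one_mul, crossVec]

/-- Test vector: the `i`-th unit vector, that is, trusting agent `i` alone. As `[C_A]_ii = [k_A]_i`,
the bound is exactly that agent's variance. -/
theorem npaeVar_le_postVar (hθ : KernelPosSemidef θ) (hn : 1 ≤ n) (i : Fin M) :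
    npaeVar θ X x ≤ postVar θ (X i) x := by
  have h := two_mul_dotProduct_sub_le (aggCov_posDef X x hθ hn) (Pi.single i 1) (crossVec θ X x)
  rw [single_dotProduct, single_dotProduct, Matrix.mulVec_single_one, Matrix.col_apply,
    aggCov_self X x hθ] at h
  have h2 : postVar θ (X i) x = seKernel θ x x - crossVec θ X x i := rfl
  rw [npaeVar, h2]
  linarith

/-- Weights of the difference of the full GP mean and the NPAE mean. -/
noncomputable def gapWeights (θ : Hyper D) (X : Fin M → Fin n → Loc D) (x : Loc D) :
    Fin M × Fin n → ℝ :=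
  expertWeights θ X x *ᵥ ((aggCov θ X x)⁻¹ *ᵥ crossVec θ X x) -
    (covMat θ (fun p : Fin M × Fin n => X p.1 p.2))⁻¹ *ᵥ
      kVec θ (fun p : Fin M × Fin n => X p.1 p.2) x

theorem npaeMean_sub_fullMean (hθ : KernelPosSemidef θ) (hn : 1 ≤ n) (y : Fin M → Fin n → ℝ) :
    npaeMean θ X y x - fullMean θ X y x = ∑ p, gapWeights θ X x p * y p.1 p.2 := by
  have hH := transpose_eq_of_posDef (aggCov_posDef X x hθ hn).inv
  have hC := transpose_eq_of_posDef
    (covMat_posDef hθ (fun p : Fin M × Fin n => X p.1 p.2)).inv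
  change _ = gapWeights θ X x ⬝ᵥ fun p : Fin M × Fin n => y p.1 p.2
  rw [npaeMean, fullMean, postMean, gapWeights, sub_dotProduct,
    dotProduct_mulVec_comm_of_isSymm hH, dotProduct_mulVec_comm_of_isSymm hC,
    localMean_eq X x hθ, dotProduct_comm ((expertWeights θ X x)ᵀ *ᵥ _), Matrix.mulVec_transpose,
    dotProduct_comm _ (Matrix.vecMul _ _), ← Matrix.dotProduct_mulVec, dotProduct_comm,
    dotProduct_comm (fun p : Fin M × Fin n => y p.1 p.2)]

/-- Pythagoras for best linear predictors: the NPAE weights `W β` satisfy `(W β)ᵀ C (W β) = (W β)ᵀ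
k_* = k_Aᵀ β`, so completing the square around the full GP weights leaves the difference of
variances. -/
theorem gapWeights_quadratic (hθ : KernelPosSemidef θ) (hn : 1 ≤ n) :
    gapWeights θ X x ⬝ᵥ (covMat θ (fun p : Fin M × Fin n => X p.1 p.2) *ᵥ gapWeights θ X x) =
      npaeVar θ X x - fullVar θ X x := by
  set β := (aggCov θ X x)⁻¹ *ᵥ crossVec θ X x with hβ
  have h1 : (expertWeights θ X x *ᵥ β) ⬝ᵥ
      (covMat θ (fun p : Fin M × Fin n => X p.1 p.2) *ᵥ (expertWeights θ X x *ᵥ β)) =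
      crossVec θ X x ⬝ᵥ β := by
    have : covMat θ (fun p : Fin M × Fin n => X p.1 p.2) *ᵥ (expertWeights θ X x *ᵥ β) =
      (covMat θ (fun p : Fin M × Fin n => X p.1 p.2) * expertWeights θ X x) *ᵥ β := by
      rw [Matrix.mulVec_mulVec]
    rw [this, dotProduct_comm, Matrix.dotProduct_mulVec, ← Matrix.mulVec_transpose,
      Matrix.mulVec_mulVec, ← Matrix.mul_assoc, ← aggCov_eq X x hθ, hβ,
      mulVec_inv_mulVec_of_posDef (aggCov_posDef X x hθ hn)]
  have h2 : (expertWeights θ X x *ᵥ β) ⬝ᵥ kVec θ (fun p : Fin M × Fin n => X p.1 p.2) x =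
      crossVec θ X x ⬝ᵥ β := by
    rw [dotProduct_comm, Matrix.dotProduct_mulVec, ← Matrix.mulVec_transpose, ← crossVec_eq]
  rw [gapWeights, quadratic_sub_inv_mulVec (covMat_posDef hθ _), ← hβ, h1, h2, npaeVar, fullVar,
    postVar, ← hβ]
  ring

theorem fullVar_le_npaeVar (hθ : KernelPosSemidef θ) (hn : 1 ≤ n) :
    fullVar θ X x ≤ npaeVar θ X x := by
  have h := gapWeights_quadratic X x hθ hn
  have h0 := (covMat_posDef hθ (fun p : Fin M × Fin n => X p.1 p.2)).posSemidef
    |>.dotProduct_mulVec_nonneg (gapWeights θ X x)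
  rw [star_trivial, h] at h0
  linarith

/-- Under infill, the NPAE prediction variance tends to zero. -/
theorem tendsto_npaeVar (hM : 0 < M) (hθ : KernelPosSemidef θ)
    {X : (n : ℕ) → Fin M → Fin n → Loc D} {S : Set (Loc D)} (hX : IsInfill X S) {x : Loc D}
    (hx : x ∈ S) : Tendsto (fun n => npaeVar θ (X n) x) atTop (𝓝 0) := by
  have : Nonempty (Fin M) := ⟨⟨0, hM⟩⟩
  -- The form with strict `n > n0` supplies `1 ≤ n`.
  rw [Metric.tendsto_atTop']
  intro r hr
  have hcont := (continuous_seKernel_left θ x).continuousAt (x := x)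
  obtain ⟨δ, hδ, hclose⟩ := Metric.continuousAt_iff.1 hcont (r / 4) (by positivity)
  obtain ⟨m, hm⟩ := exists_nat_gt (θ.sigE ^ 2 / (r / 2))
  have hE := pow_pos θ.sigE_pos 2
  have hm0 : (0 : ℝ) < m := lt_trans (by positivity) hm
  -- With `M * m` inputs near `x`, by pigeonhole some agent, depending on `n`, holds at least `m` of
  -- them. Its variance is then below `2 * (r / 4) + r / 2`.
  have hev := (hX x hx δ hδ).eventually_ge_atTop (M * m)
  obtain ⟨n0, hn0⟩ := eventually_atTop.1 hev
  refine ⟨n0, fun n hn => ?_⟩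
  have hn1 : 1 ≤ n := by lia
  have hcard := hn0 n hn.le
  classical
  set T : Finset (Fin M × Fin n) := Finset.univ.filter fun p => dist (X n p.1 p.2) x < δ with hT
  have hTc : M * m ≤ T.card := by
    rwa [Nat.card_eq_fintype_card, Fintype.card_subtype] at hcard
  obtain ⟨i, -, hi⟩ := Finset.exists_le_card_fiber_of_mul_le_card_of_maps_to (s := T)
    (t := Finset.univ) (f := Prod.fst) (n := m) (fun _ _ => Finset.mem_univ _)
    Finset.univ_nonempty (by simpa using hTc)
  set U : Finset (Fin n) := Finset.univ.filter fun a => dist (X n i a) x < δ with hU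
  have hUc : m ≤ U.card := by
    refine hi.trans (Finset.card_le_card_of_injOn Prod.snd ?_ ?_)
    · rintro ⟨j, a⟩ hp
      simp only [hT, Finset.coe_filter, Finset.mem_filter, Finset.mem_univ, true_and,
        Set.mem_ofPred_eq] at hp
      obtain ⟨h1, rfl⟩ := hp
      simpa [hU] using h1
    · rintro ⟨j, a⟩ hp ⟨j', a'⟩ hp' haa
      simp only [Finset.coe_filter, Set.mem_ofPred_eq] at hp hp' haa
      rw [Prod.mk.injEq]
      exact ⟨hp.2.trans hp'.2.symm, haa⟩
  have hUne : U.Nonempty := Finset.card_pos.1 (lt_of_lt_of_le (by exact_mod_cast hm0) hUc)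
  have h1 := postVar_le hθ (X n i) x (η := r / 4) U hUne fun a ha => by
    have := hclose (Finset.mem_filter.1 ha).2
    rw [Real.dist_eq, seKernel_self] at this
    linarith [(abs_lt.1 this).1]
  have h2 : θ.sigE ^ 2 / U.card < r / 2 := by
    have hU' : (m : ℝ) ≤ U.card := by exact_mod_cast hUc
    rw [div_lt_iff₀ (by positivity)] at hm
    rw [div_lt_iff₀ (by linarith)]
    nlinarith
  have h3 := npaeVar_le_postVar (X n) x hθ hn1 i
  have h4 := fullVar_le_npaeVar (X n) x hθ hn1
  have h5 : 0 ≤ fullVar θ (X n) x := postVar_nonneg hθ _ x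
  rw [Real.dist_eq, sub_zero, abs_of_nonneg (h5.trans h4)]
  linarith

/-- Since `0 ≤ fullVar ≤ npaeVar`, the difference is squeezed by the NPAE variance. -/
theorem tendsto_npaeVar_sub_fullVar (hM : 0 < M) (hθ : KernelPosSemidef θ)
    {X : (n : ℕ) → Fin M → Fin n → Loc D} {S : Set (Loc D)} (hX : IsInfill X S) {x : Loc D}
    (hx : x ∈ S) : Tendsto (fun n => npaeVar θ (X n) x - fullVar θ (X n) x) atTop (𝓝 0) := by
  refine squeeze_zero' ?_ ?_ (tendsto_npaeVar hM hθ hX hx)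
  · filter_upwards [eventually_ge_atTop 1] with n hn
    linarith [fullVar_le_npaeVar (X n) x hθ hn]
  · filter_upwards with n
    have : 0 ≤ fullVar θ (X n) x := postVar_nonneg hθ _ x
    linarith

end Npae

/-! ### Second moments of the observations and consistency of NPAE -/

section Model

variable {D M : ℕ} {Ω : Type*} [MeasurableSpace Ω] {P : Measure Ω}
  {θ : Hyper D} {f : Loc D → Ω → ℝ} {e : (n : ℕ) → Fin M → Fin n → Ω → ℝ}

theorem eLpNorm_two_eq_of_integral_eq_zero [IsFiniteMeasure P] {g : Ω → ℝ} (hg : MemLp g 2 P) (h0 : P[g] = 0) :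
    eLpNorm g 2 P = ENNReal.ofReal Var[g; P] ^ (1 / 2 : ℝ) := by
  rw [ofReal_variance hg, evariance, h0,
    eLpNorm_eq_lintegral_rpow_enorm_toReal two_ne_zero ENNReal.ofNat_ne_top]
  simp

variable (h : IsGPModel θ P f e)
include h

theorem IsGPModel.memLp_process (x : Loc D) : MemLp (f x) 2 P :=
  (h.gaussian.hasGaussianLaw_eval x).memLp_two

theorem IsGPModel.memLp_noise (n : ℕ) (i : Fin M) (a : Fin n) : MemLp (e n i a) 2 P :=
  (h.noise_law n i a).hasGaussianLaw.memLp_two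

theorem IsGPModel.integral_noise (n : ℕ) (i : Fin M) (a : Fin n) : P[e n i a] = 0 := by
  rw [(h.noise_law n i a).integral_eq, integral_id_gaussianReal]

theorem IsGPModel.cov_process_noise (n : ℕ) (x : Loc D) (i : Fin M) (a : Fin n) :
    cov[f x, e n i a; P] = 0 := by
  have hi : IndepFun (f x) (e n i a) P :=
    (h.indep n).comp (φ := fun z : Loc D → ℝ => z x) (ψ := fun z : Fin M × Fin n → ℝ => z (i, a))
      (measurable_pi_apply x) (measurable_pi_apply (i, a))
  exact hi.covariance_eq_zero (h.memLp_process x) (h.memLp_noise n i a)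

theorem IsGPModel.cov_noise (n : ℕ) (p q : Fin M × Fin n) :
    cov[e n p.1 p.2, e n q.1 q.2; P] = if p = q then θ.sigE ^ 2 else 0 := by
  split_ifs with hpq
  · subst hpq
    rw [covariance_self (h.memLp_noise n _ _).aemeasurable, (h.noise_law n _ _).variance_eq,
      variance_id_gaussianReal, Real.coe_toNNReal _ (sq_nonneg _)]
  · exact ((h.noise_indep n).indepFun hpq).covariance_eq_zero (h.memLp_noise n _ _)
      (h.memLp_noise n _ _)

theorem IsGPModel.memLp_obs (X : (n : ℕ) → Fin M → Fin n → Loc D) (n : ℕ) (p : Fin M × Fin n) :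
    MemLp (fun w => obs X f e n w p.1 p.2) 2 P :=
  (h.memLp_process _).add (h.memLp_noise n _ _)

variable [IsProbabilityMeasure P]

theorem IsGPModel.kernelPosSemidef : KernelPosSemidef θ :=
  kernelPosSemidef_of_cov h.memLp_process h.cov_eq

theorem IsGPModel.cov_obs (X : (n : ℕ) → Fin M → Fin n → Loc D) (n : ℕ) (p q : Fin M × Fin n) :
    cov[fun w => obs X f e n w p.1 p.2, fun w => obs X f e n w q.1 q.2; P] =
      covMat θ (fun p : Fin M × Fin n => X n p.1 p.2) p q := by
  have hf := h.memLp_process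
  have he := h.memLp_noise n
  change cov[f (X n p.1 p.2) + e n p.1 p.2, f (X n q.1 q.2) + e n q.1 q.2; P] = _
  rw [covariance_add_left (hf _) (he _ _) ((hf _).add (he _ _)),
    covariance_add_right (hf _) (hf _) (he _ _), covariance_add_right (he _ _) (hf _) (he _ _),
    h.cov_process_noise, covariance_comm (e n p.1 p.2), h.cov_process_noise, h.cov_eq,
    h.cov_noise]
  simp [covMat, Matrix.one_apply]

theorem IsGPModel.integral_obs (X : (n : ℕ) → Fin M → Fin n → Loc D) (n : ℕ)
    (p : Fin M × Fin n) : ∫ w, obs X f e n w p.1 p.2 ∂P = 0 := by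
  simp only [obs]
  rw [integral_add ((h.memLp_process _).integrable one_le_two)
    ((h.memLp_noise n _ _).integrable one_le_two), h.mean_zero, h.integral_noise, add_zero]

/-- Mean square of a linear combination of the observations. -/
theorem IsGPModel.eLpNorm_sum_obs (X : (n : ℕ) → Fin M → Fin n → Loc D) (n : ℕ)
    (c : Fin M × Fin n → ℝ) :
    eLpNorm (fun w => ∑ p, c p * obs X f e n w p.1 p.2) 2 P =
      ENNReal.ofReal (c ⬝ᵥ (covMat θ (fun p : Fin M × Fin n => X n p.1 p.2) *ᵥ c)) ^
        (1 / 2 : ℝ) := by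
  have hmem : ∀ p, MemLp (fun w => c p * obs X f e n w p.1 p.2) 2 P :=
    fun p => (h.memLp_obs X n p).const_mul _
  have hsum : MemLp (fun w => ∑ p, c p * obs X f e n w p.1 p.2) 2 P :=
    memLp_finsetSum _ fun p _ => hmem p
  rw [eLpNorm_two_eq_of_integral_eq_zero hsum, ← covariance_self hsum.aemeasurable,
    covariance_fun_sum_fun_sum hmem hmem]
  · congr 2
    simp only [covariance_const_mul_left, covariance_const_mul_right, h.cov_obs, dotProduct,
      Matrix.mulVec, Finset.mul_sum]
    exact Finset.sum_congr rfl fun p _ => Finset.sum_congr rfl fun q _ => by ring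
  · rw [integral_finsetSum _ fun p _ => (hmem p).integrable one_le_two]
    simp [integral_const_mul, h.integral_obs]

/-- The difference of means is the linear combination of observations with weights `gapWeights`, so
its `L²` norm is the square root of the variance gap, and one limit gives both claims. -/
theorem IsGPModel.isConsistent_npae (hM : 0 < M) {X : (n : ℕ) → Fin M → Fin n → Loc D}
    {S : Set (Loc D)} (hX : IsInfill X S) :
    IsConsistent θ P S X f e (fun n x w => npaeMean θ (X n) (obs X f e n w) x)
      (fun n x => npaeVar θ (X n) x) := by
  intro x hx
  have hθ := h.kernelPosSemidef
  have hgap := tendsto_npaeVar_sub_fullVar hM hθ hX hx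
  constructor
  · have h1 : Tendsto (fun n => ENNReal.ofReal (npaeVar θ (X n) x - fullVar θ (X n) x) ^
        (1 / 2 : ℝ)) atTop (𝓝 0) := by
      have := ((ENNReal.continuous_ofReal.tendsto 0).comp hgap).ennrpow_const (1 / 2)
      simpa [Function.comp_def] using this
    refine h1.congr' ?_
    filter_upwards [eventually_ge_atTop 1] with n hn
    rw [← gapWeights_quadratic (X n) x hθ hn, ← h.eLpNorm_sum_obs, ← eLpNorm_neg]
    congr 1
    ext w
    rw [Pi.neg_apply, ← npaeMean_sub_fullMean (X n) x hθ hn, neg_sub]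
  · simpa using hgap.neg

end Model

/-! ### Limits of the decentralized iterations -/

section Convergence

variable {D M n : ℕ} {θ : Hyper D} {X : Fin M → Fin n → Loc D} {x : Loc D}

/-- JOR followed by consensus yields `k_Aᵀ C_A⁻¹ b` at every agent, if the (common) relaxation
factor converges to a value in the range of convergence of JOR. -/
theorem tendsto_dac_jor (hθ : KernelPosSemidef θ) (hn : 1 ≤ n)
    {Gc : SimpleGraph (Fin M)} (hGc : StronglyComplete Gc)
    {Gd : ℕ → SimpleGraph (Fin M)} (hGd : RepeatedlyConnected Gd)
    {ε : ℝ} (hε : 0 < ε) (hεΔ : ε * maxNeighbors Gd < 1)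
    (v : Module.Basis (Fin M) ℝ (Fin M → ℝ)) {lam : Fin M → ℝ}
    (hv : ∀ k, scaledCov θ X x *ᵥ v k = lam k • v k) (b q0 : Fin M → ℝ)
    {κ : Type*} {l : Filter κ} {ω : κ → Fin M → ℝ} {ω0 : ℝ} {s t : κ → ℕ}
    (hconst : ∀ c i j, ω c i = ω c j) (hω : ∀ i, Tendsto (fun c => ω c i) l (𝓝 ω0))
    (hs : Tendsto s l atTop) (ht : Tendsto t l atTop)
    (h0 : ∀ k, 0 < ω0 * lam k ∧ ω0 * lam k < 2) (i : Fin M) :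
    Tendsto (fun c => M * dac Gd ε
      (fun j => crossVec θ X x j * jor Gc (ω c) (aggCov θ X x) b q0 (s c) j) (t c) i) l
      (𝓝 (crossVec θ X x ⬝ᵥ ((aggCov θ X x)⁻¹ *ᵥ b))) := by
  have hH := aggCov_posDef X x hθ hn
  have hωc : ∀ c, ω c = fun _ => ω c i := fun c => funext fun j => hconst c j i
  have hjor : Tendsto (fun c => jor Gc (ω c) (aggCov θ X x) b q0 (s c)) l
      (𝓝 ((aggCov θ X x)⁻¹ *ᵥ b)) := by
    have := tendsto_jor hGc (fun i => (hH.diag_pos (i := i)).ne') v hv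
      (mulVec_inv_mulVec_of_posDef hH b) q0 (hω i) hs (fun k => (h0 k).1) (fun k => (h0 k).2)
    refine this.congr fun c => ?_
    rw [← hωc c]
  have hw : Tendsto (fun c j => crossVec θ X x j *
      jor Gc (ω c) (aggCov θ X x) b q0 (s c) j) l
      (𝓝 fun j => crossVec θ X x j * ((aggCov θ X x)⁻¹ *ᵥ b) j) :=
    tendsto_pi_nhds.2 fun j => (tendsto_pi_nhds.1 hjor j).const_mul _
  -- Consensus yields the average of the products; the factor `M` restores the inner product.
  have h := (tendsto_dac_of_tendsto hGd hε hεΔ hw ht i).const_mul (M : ℝ)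
  have hM : (M : ℝ) ≠ 0 := by exact_mod_cast i.pos.ne'
  rwa [mul_div_cancel₀ _ hM] at h

end Convergence

/-- DEC-NPAE is consistent for any scheme of relaxation factors, common to all agents, that
converge to values in the range of convergence of JOR. -/
theorem IsGPModel.isConsistentMethod_dec {D M : ℕ} (hM : 0 < M) {Ω : Type*} [MeasurableSpace Ω]
    {P : Measure Ω} [IsProbabilityMeasure P] {θ : Hyper D}
    {X : (n : ℕ) → Fin M → Fin n → Loc D}
    {f : Loc D → Ω → ℝ} {e : (n : ℕ) → Fin M → Fin n → Ω → ℝ} (hmodel : IsGPModel θ P f e)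
    {S : Set (Loc D)} (hX : IsInfill X S)
    {Gc : SimpleGraph (Fin M)} (hGc : StronglyComplete Gc)
    {Gd : ℕ → SimpleGraph (Fin M)} (hGd : RepeatedlyConnected Gd)
    {ε : ℝ} (hε : 0 < ε) (hεΔ : ε * maxNeighbors Gd < 1)
    {κ : Type*} [Preorder κ] {s t : κ → ℕ} (hs : Tendsto s atTop atTop)
    (ht : Tendsto t atTop atTop) {ω : ℕ → Loc D → κ → Fin M → ℝ} {ω0 : ℕ → Loc D → ℝ}
    (hconst : ∀ n x c i j, ω n x c i = ω n x c j)
    (hω : ∀ n, 1 ≤ n → ∀ x ∈ S, ∀ i, Tendsto (fun c => ω n x c i) atTop (𝓝 (ω0 n x)))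
    (hω0 : ∀ n, 1 ≤ n → ∀ x ∈ S, ∀ (v : Module.Basis (Fin M) ℝ (Fin M → ℝ)) (lam : Fin M → ℝ),
      (∀ k, scaledCov θ (X n) x *ᵥ v k = lam k • v k) → (∀ k, 0 < lam k) →
      (∑ k, lam k = M) → ∀ k, 0 < ω0 n x * lam k ∧ ω0 n x * lam k < 2)
    (qm : ℕ → Loc D → Ω → Fin M → ℝ) (qv : ℕ → Loc D → Fin M → ℝ) :
    IsConsistentMethod θ P S X f e
      (fun n x w c => decMean θ (X n) (obs X f e n w) x Gc Gd (ω n x c) ε (qm n x w) (s c) (t c))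
      (fun n x c => decVar θ (X n) x Gc Gd (ω n x c) ε (qv n x) (s c) (t c)) := by
  have hθ := hmodel.kernelPosSemidef
  refine ⟨fun n x w => npaeMean θ (X n) (obs X f e n w) x, fun n x => npaeVar θ (X n) x,
    fun n hn x hx i => ?_, hmodel.isConsistent_npae hM hX⟩
  obtain ⟨v, lam, hv, hlam, hsum⟩ := exists_eigenbasis_diagScaled (aggCov_posDef (X n) x hθ hn)
  have h0 := hω0 n hn x hx v lam hv hlam hsum
  have hlim := fun b q0 => tendsto_dac_jor hθ hn hGc hGd hε hεΔ v hv b q0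
    (hconst n x) (hω n hn x hx) hs ht h0 i
  exact ⟨fun w => hlim _ _, (hlim _ _).const_sub _⟩

end DecGP

open DecGP in
theorem mainTheorem3 {D M : ℕ} (hM : 0 < M) {Ω : Type*} [MeasurableSpace Ω]
    (P : Measure Ω) [IsProbabilityMeasure P] (θ : Hyper D)
    (X : (n : ℕ) → Fin M → Fin n → Loc D)
    (f : Loc D → Ω → ℝ) (e : (n : ℕ) → Fin M → Fin n → Ω → ℝ) (hmodel : IsGPModel θ P f e)
    (S : Set (Loc D)) (hX : IsInfill X S)
    (Gc : SimpleGraph (Fin M)) (hGc : StronglyComplete Gc)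
    (Gd : ℕ → SimpleGraph (Fin M)) (hGd : RepeatedlyConnected Gd)
    (ε : ℝ) (hε : 0 < ε) (hεΔ : ε * maxNeighbors Gd < 1) :
    -- DEC-NPAE with a relaxation factor below 2 / M, from any JOR initialization
    (∀ ω : ℝ, 0 < ω → ω < 2 / M →
      ∀ (qm : ℕ → Loc D → Ω → Fin M → ℝ) (qv : ℕ → Loc D → Fin M → ℝ),
        IsConsistentMethod θ P S X f e
          (fun n x w (c : ℕ × ℕ) =>
            decMean θ (X n) (obs X f e n w) x Gc Gd (fun _ => ω) ε (qm n x w) c.1 c.2)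
          (fun n x (c : ℕ × ℕ) =>
            decVar θ (X n) x Gc Gd (fun _ => ω) ε (qv n x) c.1 c.2)) ∧
    -- DEC-NPAE* with the exact optimal relaxation factor, from any JOR initialization
    (∀ (qm : ℕ → Loc D → Ω → Fin M → ℝ) (qv : ℕ → Loc D → Fin M → ℝ),
        IsConsistentMethod θ P S X f e
          (fun n x w (c : ℕ × ℕ) =>
            decMean θ (X n) (obs X f e n w) x Gc Gd
              (fun _ => omegaStar (scaledCov θ (X n) x)) ε (qm n x w) c.1 c.2)
          (fun n x (c : ℕ × ℕ) =>
            decVar θ (X n) x Gc Gd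
              (fun _ => omegaStar (scaledCov θ (X n) x)) ε (qv n x) c.1 c.2)) ∧
    -- DEC-NPAE* with the relaxation factor computed by power iteration
    (∀ e0 f0 : ℕ → Loc D → Fin M → ℝ,
      (∀ n, 1 ≤ n → ∀ x ∈ S,
        HasComponent (scaledCov θ (X n) x) (eigMax (scaledCov θ (X n) x)) (e0 n x) ∧
        HasComponent (scaledCov θ (X n) x) (eigMin (scaledCov θ (X n) x)) (f0 n x)) →
      (∀ n, 1 ≤ n → ∀ x ∈ S, ∀ i,
        Tendsto (fun c : ℕ × ℕ =>
            pmOmega Gc (scaledCov θ (X n) x) (e0 n x) (f0 n x) c.1 c.2 i)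
          atTop (𝓝 (omegaStar (scaledCov θ (X n) x)))) ∧
      ∀ (qm : ℕ → Loc D → Ω → Fin M → ℝ) (qv : ℕ → Loc D → Fin M → ℝ),
        IsConsistentMethod θ P S X f e
          (fun n x w (c : (ℕ × ℕ) × (ℕ × ℕ)) =>
            decMean θ (X n) (obs X f e n w) x Gc Gd
              (pmOmega Gc (scaledCov θ (X n) x) (e0 n x) (f0 n x) c.1.1 c.1.2) ε
              (qm n x w) c.2.1 c.2.2)
          (fun n x (c : (ℕ × ℕ) × (ℕ × ℕ)) =>
            decVar θ (X n) x Gc Gd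
              (pmOmega Gc (scaledCov θ (X n) x) (e0 n x) (f0 n x) c.1.1 c.1.2) ε
              (qv n x) c.2.1 c.2.2)) := by
  have hfst : ∀ {α β : Type} [Preorder α] [Preorder β] [IsDirectedOrder α] [IsDirectedOrder β]
      [Nonempty α] [Nonempty β], Tendsto (Prod.fst : α × β → α) atTop atTop := by
    intros; rw [← prod_atTop_atTop_eq]; exact tendsto_fst
  have hsnd : ∀ {α β : Type} [Preorder α] [Preorder β] [IsDirectedOrder α] [IsDirectedOrder β]
      [Nonempty α] [Nonempty β], Tendsto (Prod.snd : α × β → β) atTop atTop := by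
    intros; rw [← prod_atTop_atTop_eq]; exact tendsto_snd
  refine ⟨fun ω hω0 hω qm qv => ?_, fun qm qv => ?_, fun e0 f0 hcomp => ?_⟩
  · refine hmodel.isConsistentMethod_dec hM hX hGc hGd hε hεΔ hfst hsnd
      (ω := fun _ _ _ _ => ω) (ω0 := fun _ _ => ω) (fun _ _ _ _ _ => rfl)
      (fun _ _ _ _ _ => tendsto_const_nhds) (fun n _ x _ v lam _ hlam hsum k => ?_) qm qv
    -- Positive eigenvalues of sum `M` are each at most `M`.
    have hk : lam k ≤ M := hsum ▸ Finset.single_le_sum (fun j _ => (hlam j).le)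
      (Finset.mem_univ k)
    refine ⟨mul_pos hω0 (hlam k), ?_⟩
    rw [lt_div_iff₀ (by exact_mod_cast hM)] at hω
    exact (mul_le_mul_of_nonneg_left hk hω0.le).trans_lt hω
  · exact hmodel.isConsistentMethod_dec hM hX hGc hGd hε hεΔ hfst hsnd
      (ω := fun n x _ _ => omegaStar (scaledCov θ (X n) x))
      (ω0 := fun n x => omegaStar (scaledCov θ (X n) x)) (fun _ _ _ _ _ => rfl)
      (fun _ _ _ _ _ => tendsto_const_nhds)
      (fun n _ x _ v lam hv hlam _ k => omegaStar_mul_pos_and_lt_two v hv hlam k) qm qv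
  · have hlim : ∀ n, 1 ≤ n → ∀ x ∈ S, ∀ i, Tendsto (fun c : ℕ × ℕ =>
        pmOmega Gc (scaledCov θ (X n) x) (e0 n x) (f0 n x) c.1 c.2 i)
        atTop (𝓝 (omegaStar (scaledCov θ (X n) x))) := by
      intro n hn x hx i
      obtain ⟨v, lam, hv, hlam, -⟩ := exists_eigenbasis_diagScaled
        (aggCov_posDef (X n) x hmodel.kernelPosSemidef hn)
      exact tendsto_pmOmega hGc v hv hlam (hcomp n hn x hx).1 (hcomp n hn x hx).2 i
    refine ⟨hlim, fun qm qv => ?_⟩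
    -- Here `c.1` counts power iterations and `c.2` JOR and consensus rounds. All grow jointly, so
    -- JOR runs with a factor that still varies with `c`.
    exact hmodel.isConsistentMethod_dec hM hX hGc hGd hε hεΔ (hfst.comp (hsnd (α := ℕ × ℕ) (β := ℕ × ℕ)))
      (hsnd.comp (hsnd (α := ℕ × ℕ) (β := ℕ × ℕ)))
      (ω := fun n x (c : (ℕ × ℕ) × (ℕ × ℕ)) =>
        pmOmega Gc (scaledCov θ (X n) x) (e0 n x) (f0 n x) c.1.1 c.1.2)
      (ω0 := fun n x => omegaStar (scaledCov θ (X n) x))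
      (fun _ _ _ _ _ => pmOmega_eq_pmOmega hGc _ _ _ _ _ _ _)
      (fun n hn x hx i => (hlim n hn x hx i).comp hfst)
      (fun n _ x _ v lam hv hlam _ k => omegaStar_mul_pos_and_lt_two v hv hlam k) qm qv
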